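/- Conventions. For a cardinal $\theta$, $H(\theta)$ is the set of all sets whose transitive closure has cardinality less than $\theta$, and $\mathcal P_\kappa X$ is the set of subsets of $X$ of cardinality less than $\kappa$. A set $C\subseteq\mathcal P_\kappa X$ is \emph{cofinal} if every $x\in\mathcal P_\kappa X$ is contained in some $y\in C$; it is a \emph{strong club} if it is cofinal and $\bigcup D\in C$ for every nonempty $D\subseteq C$ with $|D|<\kappa$. A subset of $\mathcal P_\kappa X$ is \emph{weakly stationary} if it meets every strong club in $\mathcal P_\kappa X$. Let $\mu\le\kappa\le\theta$ be uncountable cardinals with $\kappa,\theta$ regular. For $M\subseteq H(\theta)$ and $x\in M$, a set $d\subseteq x$ is \emph{$(\mu,M)$-approximated} if for every $z\in M\cap\mathcal P_\mu(x)$ there is $e\in M$ with $d\cap z=e\cap z$; and $d$ is \emph{$N$-guessed} if there is $e\in N$ with $d\cap N=e\cap N$. For $S\subseteq\mathcal P_\kappa H(\theta)$, the pair $(M,x)$ is \emph{almost $\mu$-guessed by $S$} if $x\in M$ and for every $(\mu,M)$-approximated $d\subseteq x$ there is $N\in S$ such that $x\in N\subseteq M$ and $d$ is $N$-guessed. For $\mathcal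 Y\subseteq\mathcal P_\kappa H(\theta)$, $\mathsf{wAGP}_{\mathcal Y}(\mu,\kappa,\theta)$ asserts that for every cofinal $S\subseteq\mathcal P_\kappa H(\theta)$ and every $x\in H(\theta)$, the set of $M\in\mathcal Y$ such that $(M,x)$ is almost $\mu$-guessed by $S$ is weakly stationary in $\mathcal P_\kappa H(\theta)$. A function $c:[\lambda]^2\to\chi$ is \emph{subadditive} if for all $\alpha<\beta<\gamma<\lambda$ both $c(\alpha,\gamma)\le\max\{c(\alpha,\beta),c(\beta,\gamma)\}$ and $c(\alpha,\beta)\le\max\{c(\alpha,\gamma),c(\beta,\gamma)\}$; it is \emph{strongly unbounded} if $c``[A]^2$ is unbounded in $\chi$ for every unbounded $A\subseteq\lambda$. For a regular uncountable cardinal $\lambda$, $\square(\lambda)$ asserts that there is a sequence $\langle C_\alpha\mid\alpha<\lambda\text{ limit}\rangle$ such that each $C_\alpha$ is club in $\alpha$; $C_\beta=C_\alpha\cap\beta$ whenever $\beta<\alpha$ is a limit point of $C_\alpha$; and there is no club $D\subseteq\lambda$ with $D\cap\alpha=C_\alpha$ for every limit point $\alpha<\lambda$ of $D$. Theorem. Let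 $\chi<\chi^+<\kappa\le\lambda$ be infinite cardinals with $\kappa$ regular and $\operatorname{cf}(\lambda)\ge\kappa$, let \[\mathcal Y:=\{M\in\mathcal P_\kappa H(\lambda^+)\mid \operatorname{cf}(\sup(M\cap\lambda))>\chi\},\] and suppose that $\mathsf{wAGP}_{\mathcal Y}(\kappa,\kappa,\lambda^+)$ holds. Then there is no subadditive, strongly unbounded function $c:[\lambda]^2\to\chi$. Moreover, if $\lambda$ is regular, then $\square(\lambda)$ fails. -/

import Mathlib

open Cardinal Ordinal Order Set

universe u

/-! ### `H(θ)`, `𝒫_κ X` and strong clubs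

The set-theoretic universe is `ZFSet.{u}`; a collection of subsets of `X` is a
`Set ZFSet.{u}`. -/

/-- `H(θ)`: the sets whose transitive closure has cardinality less than `θ`, equivalently the
sets contained in some transitive set of cardinality less than `θ`. -/
def hereditary (θ : Cardinal.{u}) : Set ZFSet.{u} :=
  {x | ∃ t : ZFSet.{u}, t.IsTransitive ∧ x ⊆ t ∧ t.card < θ}

/-- `𝒫_κ X`: the subsets of `X` of cardinality less than `κ`. -/
def smallSubsets (κ : Cardinal.{u}) (X : Set ZFSet.{u}) : Set ZFSet.{u} :=
  {M | (∀ y ∈ M, y ∈ X) ∧ M.card < κ}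

/-- `S` is a cofinal subset of `𝒫_κ X`. -/
def CofinalIn (κ : Cardinal.{u}) (X : Set ZFSet.{u}) (S : Set ZFSet.{u}) : Prop :=
  S ⊆ smallSubsets κ X ∧ ∀ M ∈ smallSubsets κ X, ∃ N ∈ S, M ⊆ N

/-- `C` is a strong club in `𝒫_κ X`: a cofinal subset closed under unions of arbitrary (not
necessarily linearly ordered) nonempty subcollections of cardinality less than `κ`. -/
def IsStrongClub (κ : Cardinal.{u}) (X : Set ZFSet.{u}) (C : Set ZFSet.{u}) : Prop :=
  CofinalIn κ X C ∧
    ∀ D : ZFSet.{u}, D.Nonempty → (∀ M ∈ D, M ∈ C) → D.card < κ → ZFSet.sUnion D ∈ C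

/-- `A` is a weakly stationary subset of `𝒫_κ X`: it meets every strong club. -/
def IsWeaklyStationary (κ : Cardinal.{u}) (X : Set ZFSet.{u}) (A : Set ZFSet.{u}) : Prop :=
  A ⊆ smallSubsets κ X ∧ ∀ C : Set ZFSet.{u}, IsStrongClub κ X C → (A ∩ C).Nonempty

/-! ### The weak almost guessing property -/

/-- The subset `d` of `x` is `(μ, M)`-approximated: every `z ∈ M ∩ 𝒫_μ(x)` admits `e ∈ M` with
`d ∩ z = e ∩ z`. -/
def IsApproximated (μ : Cardinal.{u}) (M x d : ZFSet.{u}) : Prop :=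
  ∀ z ∈ M, z ⊆ x → z.card < μ → ∃ e ∈ M, d ∩ z = e ∩ z

/-- `d` is `N`-guessed. -/
def IsGuessed (N d : ZFSet.{u}) : Prop :=
  ∃ e ∈ N, d ∩ N = e ∩ N

/-- `(M, x)` is almost `μ`-guessed by `S`. -/
def IsAlmostGuessed (μ : Cardinal.{u}) (S : Set ZFSet.{u}) (M x : ZFSet.{u}) : Prop :=
  x ∈ M ∧ ∀ d : ZFSet.{u}, d ⊆ x → IsApproximated μ M x d →
    ∃ N ∈ S, x ∈ N ∧ N ⊆ M ∧ IsGuessed N d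

/-- `wAGP_Y(μ, κ, θ)`. -/
def WAGP (Y : Set ZFSet.{u}) (μ κ θ : Cardinal.{u}) : Prop :=
  ∀ S : Set ZFSet.{u}, CofinalIn κ (hereditary θ) S → ∀ x ∈ hereditary θ,
    IsWeaklyStationary κ (hereditary θ)
      {M | M ∈ smallSubsets κ (hereditary θ) ∧ M ∈ Y ∧ IsAlmostGuessed μ S M x}

/-- `sup (M ∩ lam)`, where ordinals are identified with von Neumann ordinals. -/
noncomputable def supBelow (M : ZFSet.{u}) (lam : Cardinal.{u}) : Ordinal.{u} :=
  sSup {α : Ordinal.{u} | α < lam.ord ∧ α.toZFSet ∈ M}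

/-- The set of `M ∈ 𝒫_κ H(lam⁺)` with `cf (sup (M ∩ lam)) > χ`. -/
def largeCofinality (χ κ lam : Cardinal.{u}) : Set ZFSet.{u} :=
  {M | M ∈ smallSubsets κ (hereditary (succ lam)) ∧ χ < (supBelow M lam).cof}

/-! ### Subadditive functions -/

/-- `[o]²`, as the set of pairs `α < β < o`. -/
abbrev OrdPairs (o : Ordinal.{u}) : Type (u + 1) :=
  {p : Iio o × Iio o // p.1 < p.2}

/-- The two triangle inequalities for `c : [lam]² → χ`. -/
def IsSubadditive {lam χ : Cardinal.{u}} (c : OrdPairs lam.ord → Iio χ.ord) : Prop :=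
  ∀ (α β γ : Iio lam.ord) (h₁ : α < β) (h₂ : β < γ),
    c ⟨(α, γ), h₁.trans h₂⟩ ≤ max (c ⟨(α, β), h₁⟩) (c ⟨(β, γ), h₂⟩) ∧
    c ⟨(α, β), h₁⟩ ≤ max (c ⟨(α, γ), h₁.trans h₂⟩) (c ⟨(β, γ), h₂⟩)

/-- For every unbounded `A ⊆ lam`, the image of `[A]²` under `c` is unbounded in `χ`. -/
def IsStronglyUnbounded {lam χ : Cardinal.{u}} (c : OrdPairs lam.ord → Iio χ.ord) : Prop :=
  ∀ A : Set (Iio lam.ord), ¬ BddAbove A →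
    ¬ BddAbove (c '' {p | p.1.1 ∈ A ∧ p.1.2 ∈ A})

/-! ### The square principle -/

/-- The limit points of `A`: the nonzero `β` with `A ∩ β` unbounded in `β`. -/
def limitPoints (A : Set Ordinal.{u}) : Set Ordinal.{u} :=
  {β | β ≠ 0 ∧ ∀ γ < β, ∃ δ ∈ A, γ < δ ∧ δ < β}

/-- `A` is a closed unbounded subset of the ordinal `α`. -/
def IsClubIn (A : Set Ordinal.{u}) (α : Ordinal.{u}) : Prop :=
  A ⊆ Iio α ∧ (∀ γ < α, ∃ δ ∈ A, γ < δ) ∧ ∀ β < α, β ∈ limitPoints A → β ∈ A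

/-- `□(lam)`: there is a coherent sequence of clubs `C α ⊆ α`, for limit `α < lam`, with no
thread. The values of `C` at other ordinals are irrelevant. -/
def SquarePrinciple (lam : Cardinal.{u}) : Prop :=
  ∃ C : Ordinal.{u} → Set Ordinal.{u},
    (∀ α < lam.ord, IsSuccLimit α → IsClubIn (C α) α) ∧
    (∀ α < lam.ord, IsSuccLimit α → ∀ β < α, β ∈ limitPoints (C α) → C β = C α ∩ Iio β) ∧
    ¬ ∃ D : Set Ordinal.{u}, IsClubIn D lam.ord ∧
      ∀ α < lam.ord, α ∈ limitPoints D → C α = D ∩ Iio α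

/-! ### Bounding small families of ordinals -/

/-! Read `R i α β` as c(α,β) ≤ i, with c subadditive and strongly unbounded. Let M be a suitably
closed set, almost guessed, with δ = sup(M ∩ λ) of cofinality above χ. Then a single i satisfies `R
i β δ` for cofinally many β ∈ M, and by subadditivity every level j ≥ i of c(·,δ) agrees below such
β with the same level of c(·,β). So the set d coding these levels is approximated by M
(`IsRich.isApproximated`).

No closed directed N ⊆ M guesses d (`IsRich.not_isGuessed`). Given a guess e ∈ N, for each j < χ the
set N contains either a bound for the j-th slice of e, or u < v in that slice with `¬ R j u v`. Some
s ∈ N exceeds all these bounds; it lies in some slice, which therefore has a bad pair u < v. Both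
are at that level below δ, so subadditivity makes the pair good, a contradiction. As χ⁺ < κ, such N
are cofinal (`exists_closed_directed`), which contradicts wAGP.

For the square, a coherent sequence without a thread allows stationary sets to be split coherently ω
times, giving weights h : λ → ω that are constant along limit points (`exists_coherent_coloring`).
The maximal weight met on walks is subadditive (`IsWeightedCSeq.walkBound_subadditive`), and
strongly unbounded because large weights are stationary. This is the case χ = ℵ₀ of the first part.
-/

theorem exists_strict_bound_of_card_lt_cof {ι δ : Ordinal.{u}} {f : Ordinal.{u} → Ordinal.{u}}
    (h : ι.card < δ.cof) (hf : ∀ i < ι, f i < δ) : ∃ s < δ, ∀ i < ι, f i < s := by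
  have hlt : sSup ((· + 1) '' (f '' Iio ι)) < δ := by
    refine sSup_add_one_lt_of_lt_cof ?_ (by rintro _ ⟨i, hi, rfl⟩; exact hf i hi)
    refine mk_image_le.trans_lt ?_
    rwa [Cardinal.mk_Iio_ordinal, ← lift_cof, Cardinal.lift_lt]
  refine ⟨_, hlt, fun i hi => ?_⟩
  refine (lt_add_one (f i)).trans_le (le_csSup ⟨δ, ?_⟩ ⟨f i, ⟨i, hi, rfl⟩, rfl⟩)
  rintro _ ⟨_, ⟨j, hj, rfl⟩, rfl⟩
  exact Order.add_one_le_of_lt (hf j hj)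

theorem exists_strict_bound_of_zfset_card_lt_cof {a : ZFSet.{u}} {δ : Ordinal.{u}}
    (h : a.card < δ.cof) : ∃ s < δ, ∀ α < δ, α.toZFSet ∈ a → α < s := by
  have hlt : sSup ((· + 1) '' {α : Ordinal.{u} | α < δ ∧ α.toZFSet ∈ a}) < δ := by
    refine sSup_add_one_lt_of_lt_cof ?_ (fun i hi => hi.1)
    have h1 : #{α : Ordinal.{u} | α < δ ∧ α.toZFSet ∈ a} ≤ #a :=
      mk_le_of_injective (f := fun α => ⟨α.1.toZFSet, α.2.2⟩) fun α β hαβ =>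
        Subtype.ext (toZFSet_injective (congrArg Subtype.val hαβ))
    refine h1.trans_lt ?_
    rwa [ZFSet.cardinalMk_coe_sort, ← lift_cof, Cardinal.lift_lt]
  refine ⟨_, hlt, fun α hα ha => ?_⟩
  refine (lt_add_one α).trans_le (le_csSup ⟨δ, ?_⟩ ⟨α, ⟨hα, ha⟩, rfl⟩)
  rintro _ ⟨β, hβ, rfl⟩
  exact Order.add_one_le_of_lt hβ.1

/-! ### Stationary sets of ordinals -/

/-- `A` is an unbounded subset of `o`. -/
def IsUnboundedIn (A : Set Ordinal.{u}) (o : Ordinal.{u}) : Prop :=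
  A ⊆ Iio o ∧ ∀ γ < o, ∃ δ ∈ A, γ < δ

/-- `S` contains, for each unbounded `A ⊆ o`, a limit point of `A` below `o`. -/
def IsStationaryIn (S : Set Ordinal.{u}) (o : Ordinal.{u}) : Prop :=
  ∀ A, IsUnboundedIn A o → ∃ β ∈ S, β < o ∧ β ∈ limitPoints A

theorem isSuccLimit_of_mem_limitPoints {A : Set Ordinal.{u}} {β : Ordinal.{u}}
    (h : β ∈ limitPoints A) : IsSuccLimit β := by
  refine ⟨by simpa using h.1, fun γ hγ => ?_⟩
  obtain ⟨δ, -, h1, h2⟩ := h.2 γ hγ.lt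
  exact hγ.2 h1 h2

theorem limitPoints_mono {A B : Set Ordinal.{u}} (h : A ⊆ B) : limitPoints A ⊆ limitPoints B :=
  fun _ hβ => ⟨hβ.1, fun γ hγ => let ⟨δ, hδ, h'⟩ := hβ.2 γ hγ; ⟨δ, h hδ, h'⟩⟩

theorem mem_limitPoints_inter_Iio {A : Set Ordinal.{u}} {β γ : Ordinal.{u}} (h : β ≤ γ) :
    β ∈ limitPoints (A ∩ Iio γ) ↔ β ∈ limitPoints A :=
  ⟨fun hβ => limitPoints_mono inter_subset_left hβ, fun hβ => ⟨hβ.1, fun ζ hζ =>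
    let ⟨δ, hδ, h1, h2⟩ := hβ.2 ζ hζ; ⟨δ, ⟨hδ, h2.trans_le h⟩, h1, h2⟩⟩⟩

theorem sSup_mem_limitPoints {A L : Set Ordinal.{u}} (hL : L ⊆ limitPoints A) (hne : L.Nonempty)
    (hbdd : BddAbove L) : sSup L ∈ limitPoints A := by
  obtain ⟨μ, hμ⟩ := hne
  refine ⟨((pos_iff_ne_zero.2 (hL hμ).1).trans_le (le_csSup hbdd hμ)).ne', fun γ hγ => ?_⟩
  obtain ⟨ν, hν, hγν⟩ := exists_lt_of_lt_csSup ⟨μ, hμ⟩ hγ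
  obtain ⟨δ, hδ, h1, h2⟩ := (hL hν).2 γ hγν
  exact ⟨δ, hδ, h1, h2.trans_le (le_csSup hbdd hν)⟩

/-- The least s with X ∩ s infinite is a limit point: a gap of X below s would make X ∩ s finite. -/
theorem exists_limitPoint_of_infinite {X : Set Ordinal.{u}} (hX : X.Infinite) {α : Ordinal.{u}}
    (hα : ∀ ξ ∈ X, ξ < α) : ∃ μ ∈ limitPoints X, μ ≤ α ∧ ∃ ξ ∈ X, ξ < μ := by
  have hXα : (X ∩ Iio α).Infinite := by rwa [inter_eq_left.2 (show X ⊆ Iio α from hα)]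
  have hne : {s : Ordinal.{u} | (X ∩ Iio s).Infinite}.Nonempty := ⟨α, hXα⟩
  set s := sInf {s : Ordinal.{u} | (X ∩ Iio s).Infinite}
  have hs : (X ∩ Iio s).Infinite := csInf_mem hne
  obtain ⟨ξ, hξ⟩ := hs.nonempty
  refine ⟨s, ⟨(pos_of_gt hξ.2).ne', fun γ hγ => ?_⟩,
    csInf_le' hXα, ξ, hξ.1, hξ.2⟩
  by_contra! hcon
  have hfin : (X ∩ Iio γ).Finite := not_infinite.1 fun h => (csInf_le' h).not_gt hγ
  refine hs ((hfin.insert γ).subset fun δ hδ => ?_)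
  rcases lt_trichotomy δ γ with h | h | h
  · exact Or.inr ⟨hδ.1, h⟩
  · exact Or.inl h
  · exact absurd hδ.2 (not_lt.2 (hcon δ hδ.1 h))

section Regular

variable {lam : Cardinal.{u}}

/-- The diagonal intersection of clubs, phrased with limit points of unbounded sets. Closing off ω
times under a bound for all choices f τ ξ stays below λ, whose cofinality is uncountable. -/
theorem exists_diagonal_limitPoints (hreg : lam.IsRegular) (hunc : ℵ₀ < lam)
    {A : Ordinal.{u} → Set Ordinal.{u}} (hA : ∀ τ < lam.ord, IsUnboundedIn (A τ) lam.ord) :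
    ∃ B, IsUnboundedIn B lam.ord ∧
      ∀ β ∈ limitPoints B, ∀ τ < β, β ∈ limitPoints (A τ) := by
  have hcard : ∀ s < lam.ord, s.card < lam.ord.cof := fun s hs => by
    rw [hreg.cof_ord]; exact lt_ord.1 hs
  have h0 : ∀ τ ξ, ∃ δ, τ < lam.ord → ξ < lam.ord → δ ∈ A τ ∧ ξ < δ := fun τ ξ => by
    by_cases h : τ < lam.ord ∧ ξ < lam.ord
    · obtain ⟨δ, h1, h2⟩ := (hA τ h.1).2 ξ h.2
      exact ⟨δ, fun _ _ => ⟨h1, h2⟩⟩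
    · exact ⟨0, fun h1 h2 => absurd ⟨h1, h2⟩ h⟩
  choose f hf using h0
  have h1 : ∀ s, ∃ t, s < lam.ord → t < lam.ord ∧ s ≤ t ∧ ∀ τ < s, ∀ ξ < s, f τ ξ < t := fun s => by
    by_cases hs : s < lam.ord
    · have h2 : ∀ ξ, ∃ t, ξ < s → t < lam.ord ∧ ∀ τ < s, f τ ξ < t := fun ξ => by
        by_cases hξ : ξ < s
        · obtain ⟨t, ht, ht'⟩ := exists_strict_bound_of_card_lt_cof (f := fun τ => f τ ξ)
            (hcard s hs) fun τ hτ => (hA τ (hτ.trans hs)).1 (hf τ ξ (hτ.trans hs) (hξ.trans hs)).1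
          exact ⟨t, fun _ => ⟨ht, ht'⟩⟩
        · exact ⟨0, fun h => absurd h hξ⟩
      choose g hg using h2
      obtain ⟨t, ht, ht'⟩ := exists_strict_bound_of_card_lt_cof (f := g) (hcard s hs)
        fun ξ hξ => (hg ξ hξ).1
      exact ⟨max s t, fun _ => ⟨max_lt hs ht, le_max_left _ _, fun τ hτ ξ hξ =>
        ((hg ξ hξ).2 τ hτ).trans ((ht' ξ hξ).trans_le (le_max_right _ _))⟩⟩
    · exact ⟨0, fun h => absurd h hs⟩
  choose g hg using h1
  refine ⟨{β | β < lam.ord ∧ ∀ τ < β, ∀ ξ < β, ∃ δ ∈ A τ, ξ < δ ∧ δ < β}, ⟨fun β h => h.1, ?_⟩, ?_⟩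
  · intro γ hγ
    have hlim : IsSuccLimit lam.ord := isSuccLimit_ord hreg.aleph0_le
    have hs : ∀ n : ℕ, g^[n] (succ γ) < lam.ord := fun n => by
      induction n with
      | zero => exact hlim.succ_lt hγ
      | succ n ih => rw [Function.iterate_succ_apply']; exact (hg _ ih).1
    have hsup : ⨆ n : ℕ, g^[n] (succ γ) < lam.ord := by
      refine lift_iSup_lt_of_lt_cof ?_ hs
      simpa [hreg.cof_ord] using hunc
    have hle : ∀ n : ℕ, g^[n] (succ γ) ≤ ⨆ n : ℕ, g^[n] (succ γ) := fun n =>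
      Ordinal.le_iSup (fun n : ℕ => g^[n] (succ γ)) n
    have hmono : Monotone fun n : ℕ => g^[n] (succ γ) := monotone_nat_of_le_succ fun n => by
      simp only [Function.iterate_succ_apply']
      exact (hg _ (hs n)).2.1
    refine ⟨_, ⟨hsup, fun τ hτ ξ hξ => ?_⟩, (lt_succ γ).trans_le (hle 0)⟩
    obtain ⟨m, hm⟩ := Ordinal.lt_iSup_iff.1 hτ
    obtain ⟨n, hn⟩ := Ordinal.lt_iSup_iff.1 hξ
    have hm' := hm.trans_le (hmono (le_max_left m n))
    have hn' := hn.trans_le (hmono (le_max_right m n))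
    refine ⟨f τ ξ, (hf τ ξ (hτ.trans hsup) (hξ.trans hsup)).1,
      (hf τ ξ (hτ.trans hsup) (hξ.trans hsup)).2,
      lt_of_lt_of_le ?_ (hle (max m n + 1))⟩
    rw [Function.iterate_succ_apply']
    exact (hg _ (hs _)).2.2 τ hm' ξ hn'
  · intro β hβ τ hτ
    refine ⟨hβ.1, fun γ hγ => ?_⟩
    obtain ⟨β', hβ', h1, h2⟩ := hβ.2 _ (max_lt hτ hγ)
    obtain ⟨δ, hδ, h3, h4⟩ := hβ'.2 τ ((le_max_left _ _).trans_lt h1) γ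
      ((le_max_right _ _).trans_lt h1)
    exact ⟨δ, hδ, h3, h4.trans h2⟩

theorem exists_gt_of_isStationaryIn {S A : Set Ordinal.{u}} {o : Ordinal.{u}}
    (hS : IsStationaryIn S o) (hA : IsUnboundedIn A o) {γ : Ordinal.{u}} (hγ : γ < o) :
    ∃ β ∈ S, β < o ∧ β ∈ limitPoints A ∧ γ < β := by
  obtain ⟨β, hβS, hβ, hβA⟩ := hS (A ∩ Ioi γ) ⟨fun _ h => hA.1 h.1, fun ξ hξ => by
    obtain ⟨δ, hδ, h⟩ := hA.2 _ (max_lt hξ hγ)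
    exact ⟨δ, ⟨hδ, (le_max_right _ _).trans_lt h⟩, (le_max_left _ _).trans_lt h⟩⟩
  obtain ⟨δ, hδ, -, h⟩ := hβA.2 0 (pos_iff_ne_zero.2 hβA.1)
  exact ⟨β, hβS, hβ, limitPoints_mono inter_subset_left hβA, hδ.2.trans h⟩

/-- The clubs `C α` cohere along their limit points, below the ordinal `o`. -/
def IsCoherentClubSeq (C : Ordinal.{u} → Set Ordinal.{u}) (o : Ordinal.{u}) : Prop :=
  (∀ α < o, IsSuccLimit α → IsClubIn (C α) α) ∧
    ∀ α < o, IsSuccLimit α → ∀ β < α, β ∈ limitPoints (C α) → C β = C α ∩ Iio β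

/-- Above `ζ`, membership in `S` is inherited along limit points of the clubs. -/
def IsCoherentAbove (C : Ordinal.{u} → Set Ordinal.{u}) (o ζ : Ordinal.{u})
    (S : Set Ordinal.{u}) : Prop :=
  ∀ γ < o, IsSuccLimit γ → ∀ β < γ, β ∈ limitPoints (C γ) → ζ < β → (β ∈ S ↔ γ ∈ S)

/-- If no ζ splits S, then each ζ is decided: its membership in C β is constant for β ∈ S among the
limit points of some unbounded set. The majority set D then satisfies C β = D ∩ β for unboundedly
many β by diagonalization, so D is a thread. -/
theorem exists_stationary_split (hreg : lam.IsRegular) (hunc : ℵ₀ < lam)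
    {C : Ordinal.{u} → Set Ordinal.{u}} (hC : IsCoherentClubSeq C lam.ord)
    (hthread : ¬ ∃ D : Set Ordinal.{u}, IsClubIn D lam.ord ∧
      ∀ α < lam.ord, α ∈ limitPoints D → C α = D ∩ Iio α)
    {S : Set Ordinal.{u}} (hS : IsStationaryIn S lam.ord) :
    ∃ ζ < lam.ord, IsStationaryIn {β ∈ S | ζ ∈ C β} lam.ord ∧
      IsStationaryIn {β ∈ S | ζ ∉ C β} lam.ord := by
  by_contra! hcon
  set D : Set Ordinal.{u} := {ζ | ζ < lam.ord ∧ IsStationaryIn {β ∈ S | ζ ∈ C β} lam.ord}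
  have h0 : ∀ ζ, ∃ A, ζ < lam.ord → IsUnboundedIn A lam.ord ∧
      ∀ β ∈ S, β < lam.ord → β ∈ limitPoints A → (ζ ∈ C β ↔ ζ ∈ D) := fun ζ => by
    by_cases hζ : ζ < lam.ord
    · by_cases hs : IsStationaryIn {β ∈ S | ζ ∈ C β} lam.ord
      · have := hcon ζ hζ hs
        unfold IsStationaryIn at this
        push Not at this
        obtain ⟨A, hA, hA'⟩ := this
        refine ⟨A, fun _ => ⟨hA, fun β hβS hβ hβA => iff_of_true ?_ ⟨hζ, hs⟩⟩⟩
        by_contra hn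
        exact hA' β ⟨hβS, hn⟩ hβ hβA
      · have := hs
        unfold IsStationaryIn at this
        push Not at this
        obtain ⟨A, hA, hA'⟩ := this
        exact ⟨A, fun _ => ⟨hA, fun β hβS hβ hβA =>
          iff_of_false (fun hn => hA' β ⟨hβS, hn⟩ hβ hβA) fun h => hs h.2⟩⟩
    · exact ⟨∅, fun h => absurd h hζ⟩
  choose A hA using h0
  obtain ⟨B, hB, hB'⟩ := exists_diagonal_limitPoints hreg hunc fun τ hτ => (hA τ hτ).1
  have key : ∀ γ < lam.ord, ∃ β, γ < β ∧ β < lam.ord ∧ IsSuccLimit β ∧ C β = D ∩ Iio β := by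
    intro γ hγ
    obtain ⟨β, hβS, hβ, hβB, hγβ⟩ := exists_gt_of_isStationaryIn hS hB hγ
    have hlim := isSuccLimit_of_mem_limitPoints hβB
    have : ∀ ζ < β, (ζ ∈ C β ↔ ζ ∈ D) := fun ζ hζ =>
      (hA ζ (hζ.trans hβ)).2 β hβS hβ (hB' β hβB ζ hζ)
    refine ⟨β, hγβ, hβ, hlim, Set.ext fun ζ => ⟨fun h => ?_, fun h => (this ζ h.2).2 h.1⟩⟩
    have hζ := (hC.1 β hβ hlim).1 h
    exact ⟨(this ζ hζ).1 h, hζ⟩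
  refine hthread ⟨D, ⟨fun _ h => h.1, fun γ hγ => ?_, fun α hα hαD => ?_⟩, fun α hα hαD => ?_⟩
  · obtain ⟨β, hγβ, hβ, hlim, hCβ⟩ := key γ hγ
    obtain ⟨δ, hδ, h⟩ := (hC.1 β hβ hlim).2.1 γ hγβ
    exact ⟨δ, (hCβ ▸ hδ).1, h⟩
  · obtain ⟨β, hαβ, hβ, hlim, hCβ⟩ := key α hα
    have := (hC.1 β hβ hlim).2.2 α hαβ (by rwa [hCβ, mem_limitPoints_inter_Iio hαβ.le])
    exact (hCβ ▸ this).1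
  · obtain ⟨β, hαβ, hβ, hlim, hCβ⟩ := key α hα
    rw [hC.2 β hβ hlim α hαβ (by rwa [hCβ, mem_limitPoints_inter_Iio hαβ.le]), hCβ, inter_assoc,
      Iio_inter_Iio, inf_eq_right.2 hαβ.le]

/-- Splitting by "ζ ∈ C β" preserves coherence: for a limit point β > ζ of C γ, the sets C β and C γ
agree at ζ. -/
theorem exists_coherent_stationary_split (hreg : lam.IsRegular) (hunc : ℵ₀ < lam)
    {C : Ordinal.{u} → Set Ordinal.{u}} (hC : IsCoherentClubSeq C lam.ord)
    (hthread : ¬ ∃ D : Set Ordinal.{u}, IsClubIn D lam.ord ∧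
      ∀ α < lam.ord, α ∈ limitPoints D → C α = D ∩ Iio α)
    {S : Set Ordinal.{u}} (hS : IsStationaryIn S lam.ord)
    (hS' : ∃ ζ < lam.ord, IsCoherentAbove C lam.ord ζ S) :
    ∃ S' ⊆ S, IsStationaryIn S' lam.ord ∧ IsStationaryIn (S \ S') lam.ord ∧
      ∃ ζ < lam.ord, IsCoherentAbove C lam.ord ζ S' := by
  obtain ⟨ξ, hξ, h⟩ := hS'
  obtain ⟨ζ, hζ, h1, h2⟩ := exists_stationary_split hreg hunc hC hthread hS
  refine ⟨{β ∈ S | ζ ∈ C β}, fun β hβ => hβ.1, h1, ?_, max ξ ζ, max_lt hξ hζ, ?_⟩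
  · convert h2 using 1
    ext β
    simp only [mem_sdiff, mem_ofPred_eq, not_and]
    tauto
  · intro γ hγ hlim β hβ hβC hlt
    have := h γ hγ hlim β hβ hβC ((le_max_left _ _).trans_lt hlt)
    simp only [mem_ofPred_eq, this, hC.2 γ hγ hlim β hβ hβC, mem_inter_iff, mem_Iio,
      (le_max_right ξ ζ).trans_lt hlt, and_true]

/-- A coherent sequence of clubs without a thread carries, above some `ζ`, a colouring by natural
numbers that is constant along limit points and has stationarily many large values. -/
theorem exists_coherent_coloring (hreg : lam.IsRegular) (hunc : ℵ₀ < lam)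
    {C : Ordinal.{u} → Set Ordinal.{u}} (hC : IsCoherentClubSeq C lam.ord)
    (hthread : ¬ ∃ D : Set Ordinal.{u}, IsClubIn D lam.ord ∧
      ∀ α < lam.ord, α ∈ limitPoints D → C α = D ∩ Iio α) :
    ∃ ζ < lam.ord, ∃ h : Ordinal.{u} → ℕ,
      (∀ γ < lam.ord, IsSuccLimit γ → ∀ β < γ, β ∈ limitPoints (C γ) → ζ < β → h β = h γ) ∧
      ∀ n, IsStationaryIn {β | n < h β} lam.ord := by
  let P : Set Ordinal.{u} → Prop := fun S =>
    IsStationaryIn S lam.ord ∧ ∃ ζ < lam.ord, IsCoherentAbove C lam.ord ζ S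
  have hP : ∀ S, P S → ∃ S' ⊆ S, IsStationaryIn (S \ S') lam.ord ∧ P S' := fun S hS => by
    obtain ⟨S', h1, h2, h3, h4⟩ := exists_coherent_stationary_split hreg hunc hC hthread hS.1 hS.2
    exact ⟨S', h1, h3, h2, h4⟩
  have hpos : 0 < lam.ord := hreg.ord_pos
  have huniv : P univ := ⟨fun A hA => by
    obtain ⟨β, hβ⟩ : ∃ β < lam.ord, β ∈ limitPoints A := by
      have hcof : ℵ₀ < lam.ord.cof := by rwa [hreg.cof_ord]
      choose! f hf using hA.2
      have hs : ∀ n : ℕ, f^[n] 0 < lam.ord := fun n => by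
        induction n with
        | zero => exact hpos
        | succ n ih => rw [Function.iterate_succ_apply']; exact hA.1 (hf _ ih).1
      refine ⟨⨆ n : ℕ, f^[n] 0, lift_iSup_lt_of_lt_cof (by simpa using hcof) hs, ?_⟩
      have hlt : ∀ n : ℕ, f^[n] 0 < ⨆ n : ℕ, f^[n] 0 := fun n =>
        lt_of_lt_of_le (b := f^[n + 1] 0) (by
          rw [Function.iterate_succ_apply']; exact (hf _ (hs n)).2) (Ordinal.le_iSup _ _)
      refine ⟨(hlt 0).ne_bot, fun γ hγ => ?_⟩
      obtain ⟨n, hn⟩ := Ordinal.lt_iSup_iff.1 hγ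
      refine ⟨f^[n + 1] 0, ?_, ?_, hlt _⟩
      · rw [Function.iterate_succ_apply']; exact (hf _ (hs n)).1
      · rw [Function.iterate_succ_apply']; exact hn.trans (hf _ (hs n)).2
    exact ⟨β, mem_univ _, hβ⟩, 0, hpos, fun _ _ _ _ _ _ _ => by simp⟩
  choose! F hF using hP
  let S : ℕ → Set Ordinal.{u} := fun n => F^[n] univ
  have hSP : ∀ n, P (S n) := fun n => by
    induction n with
    | zero => exact huniv
    | succ n ih => simp only [S, Function.iterate_succ_apply']; exact (hF _ ih).2.2
  have hS1 : ∀ n, S (n + 1) = F (S n) := fun n => Function.iterate_succ_apply' F n univ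
  have hanti : Antitone S := antitone_nat_of_succ_le fun n => by
    rw [hS1]; exact (hF _ (hSP n)).1
  choose z hz hz' using fun n => (hSP n).2
  -- The colour is the first n with β ∉ S n, so it is n + 1 on the stationary set S n \ S (n + 1).
  -- Points of every S n get the harmless colour 0.
  refine ⟨⨆ n, z n, ?_, fun β => sInf {n | β ∉ S n}, ?_, fun n => ?_⟩
  · refine lift_iSup_lt_of_lt_cof ?_ hz
    simpa [hreg.cof_ord] using hunc
  · intro γ hγ hlim β hβ hβC hlt
    have : ∀ n, β ∉ S n ↔ γ ∉ S n := fun n => not_congr <|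
      hz' n γ hγ hlim β hβ hβC ((Ordinal.le_iSup z n).trans_lt hlt)
    simp only [this]
  · intro A hA
    obtain ⟨β, hβ, hβ'⟩ := (hF _ (hSP n)).2.1 A hA
    rw [← hS1] at hβ
    refine ⟨β, ?_, hβ'⟩
    have hmem : β ∉ S (sInf {n | β ∉ S n}) := Nat.sInf_mem (s := {n | β ∉ S n}) ⟨n + 1, hβ.2⟩
    by_contra hle
    exact hmem (hanti (not_lt.1 hle) hβ.1)

end Regular

/-! ### A subadditive family of relations from a coherent sequence of clubs -/

/-- `ξ ∈ C γ ∩ α` lies at or above the last limit point of `C γ` that is at most `α`. -/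
def IsTailPoint (C : Ordinal.{u} → Set Ordinal.{u}) (γ ξ α : Ordinal.{u}) : Prop :=
  ξ ∈ C γ ∧ ξ < α ∧ ∀ μ ∈ limitPoints (C γ), μ ≤ α → μ ≤ ξ

/-- Todorčević's maximal-weight relation "`ρ α β ≤ n`" along a `C`-sequence whose members are
weighted by `h`. -/
inductive WalkBound (C : Ordinal.{u} → Set Ordinal.{u}) (h : Ordinal.{u} → ℕ) (n : ℕ) :
    Ordinal.{u} → Ordinal.{u} → Prop
  | refl (α : Ordinal.{u}) : WalkBound C h n α α
  | step {α γ η : Ordinal.{u}} (hlt : α < γ) (hn : h γ ≤ n) (hη : η ∈ C γ) (hαη : α ≤ η)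
      (hmin : ∀ ξ ∈ C γ, α ≤ ξ → η ≤ ξ) (hw : WalkBound C h n α η)
      (ht : ∀ ξ, IsTailPoint C γ ξ α → WalkBound C h n ξ α) : WalkBound C h n α γ

/-- A `C`-sequence below `o`, coherent and with coherent weights `h`. -/
structure IsWeightedCSeq (C : Ordinal.{u} → Set Ordinal.{u}) (h : Ordinal.{u} → ℕ)
    (o : Ordinal.{u}) : Prop where
  subset : ∀ γ < o, C γ ⊆ Iio γ
  exists_ge : ∀ γ < o, ∀ α < γ, ∃ η ∈ C γ, α ≤ η
  closed : ∀ γ < o, ∀ μ < γ, μ ∈ limitPoints (C γ) → μ ∈ C γ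
  coherent : ∀ γ < o, ∀ μ < γ, μ ∈ limitPoints (C γ) → C μ = C γ ∩ Iio μ
  weight : ∀ γ < o, ∀ μ < γ, μ ∈ limitPoints (C γ) → h μ = h γ

section WalkBound

variable {C : Ordinal.{u} → Set Ordinal.{u}} {h : Ordinal.{u} → ℕ} {o : Ordinal.{u}} {n : ℕ}

theorem WalkBound.inv {α γ : Ordinal.{u}} (hw : WalkBound C h n α γ) (hlt : α < γ) :
    h γ ≤ n ∧ (∃ η ∈ C γ, α ≤ η ∧ (∀ ξ ∈ C γ, α ≤ ξ → η ≤ ξ) ∧ WalkBound C h n α η) ∧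
      ∀ ξ, IsTailPoint C γ ξ α → WalkBound C h n ξ α := by
  cases hw with
  | refl => exact absurd hlt (lt_irrefl _)
  | step _ hn hη hαη hmin hw ht => exact ⟨hn, ⟨_, hη, hαη, hmin, hw⟩, ht⟩

theorem WalkBound.mono {m : ℕ} (hnm : n ≤ m) {α γ : Ordinal.{u}} (hw : WalkBound C h n α γ) :
    WalkBound C h m α γ := by
  induction hw with
  | refl => exact .refl _
  | step hlt hn hη hαη hmin _ _ ih ih' => exact .step hlt (hn.trans hnm) hη hαη hmin ih ih'

theorem IsWeightedCSeq.exists_min (hC : IsWeightedCSeq C h o) {γ α : Ordinal.{u}} (hγ : γ < o)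
    (hα : α < γ) : ∃ η ∈ C γ, α ≤ η ∧ ∀ ξ ∈ C γ, α ≤ ξ → η ≤ ξ := by
  have hne : {η | η ∈ C γ ∧ α ≤ η}.Nonempty := hC.exists_ge γ hγ α hα
  have hmem := csInf_mem hne
  exact ⟨sInf {η | η ∈ C γ ∧ α ≤ η}, hmem.1, hmem.2, fun ξ hξ hαξ => csInf_le' ⟨hξ, hαξ⟩⟩

/-- Since C μ = C γ ∩ μ and the weights agree, the first step of the walk to α and the tail points
are the same from γ as from μ. -/
theorem IsWeightedCSeq.walkBound_limitPoint_iff (hC : IsWeightedCSeq C h o)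
    {γ μ α : Ordinal.{u}} (hγ : γ < o) (hμγ : μ < γ) (hμ : μ ∈ limitPoints (C γ)) (hα : α < μ) :
    WalkBound C h n α γ ↔ WalkBound C h n α μ := by
  have hcoh := hC.coherent γ hγ μ hμγ hμ
  have hwt := hC.weight γ hγ μ hμγ hμ
  have htail : ∀ ξ, IsTailPoint C γ ξ α ↔ IsTailPoint C μ ξ α := fun ξ => by
    constructor
    · rintro ⟨h1, h2, h3⟩
      exact ⟨hcoh ▸ ⟨h1, h2.trans hα⟩, h2, fun ν hν hνα =>
        h3 ν ((mem_limitPoints_inter_Iio (hνα.trans hα.le)).1 (hcoh ▸ hν)) hνα⟩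
    · rintro ⟨h1, h2, h3⟩
      exact ⟨(hcoh ▸ h1 : ξ ∈ C γ ∩ Iio μ).1, h2, fun ν hν hνα =>
        h3 ν (hcoh ▸ (mem_limitPoints_inter_Iio (hνα.trans hα.le)).2 hν) hνα⟩
  constructor
  · intro hw
    obtain ⟨h1, ⟨η, hη, hαη, hmin, hw⟩, h3⟩ := hw.inv (hα.trans hμγ)
    obtain ⟨δ, hδ, hαδ, hδμ⟩ := hμ.2 α hα
    refine .step hα (hwt ▸ h1) (hcoh ▸ ⟨hη, (hmin δ hδ hαδ.le).trans_lt hδμ⟩) hαη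
      (fun ξ hξ hαξ => hmin ξ (hcoh ▸ hξ : ξ ∈ C γ ∩ Iio μ).1 hαξ) hw
      fun ξ hξ => h3 ξ ((htail ξ).2 hξ)
  · intro hw
    obtain ⟨h1, ⟨η, hη, hαη, hmin, hw⟩, h3⟩ := hw.inv hα
    have hη' : η ∈ C γ ∩ Iio μ := hcoh ▸ hη
    refine .step (hα.trans hμγ) (hwt ▸ h1) hη'.1 hαη (fun ξ hξ hαξ => ?_) hw
      fun ξ hξ => h3 ξ ((htail ξ).1 hξ)
    rcases lt_or_ge ξ μ with h | h
    · exact hmin ξ (hcoh ▸ ⟨hξ, h⟩) hαξ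
    · exact hη'.2.le.trans h

theorem IsWeightedCSeq.exists_last_limitPoint (hC : IsWeightedCSeq C h o)
    {γ β : Ordinal.{u}} (hγ : γ < o) (hβ : β < γ) {μ : Ordinal.{u}} (hμ : μ ∈ limitPoints (C γ))
    (hμβ : μ ≤ β) : ∃ ν ∈ limitPoints (C γ), ν ∈ C γ ∧ μ ≤ ν ∧ ν ≤ β ∧
      ∀ ξ ∈ limitPoints (C γ), ξ ≤ β → ξ ≤ ν := by
  have hbdd : BddAbove {ξ | ξ ∈ limitPoints (C γ) ∧ ξ ≤ β} := ⟨β, fun _ h => h.2⟩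
  have hmem := sSup_mem_limitPoints (A := C γ) (L := {ξ | ξ ∈ limitPoints (C γ) ∧ ξ ≤ β})
    (fun _ h => h.1) ⟨μ, hμ, hμβ⟩ hbdd
  have hle : sSup {ξ | ξ ∈ limitPoints (C γ) ∧ ξ ≤ β} ≤ β := csSup_le' fun _ h => h.2
  exact ⟨_, hmem, hC.closed γ hγ _ (hle.trans_lt hβ) hmem, le_csSup hbdd ⟨hμ, hμβ⟩, hle,
    fun ξ hξ hξβ => le_csSup hbdd ⟨hξ, hξβ⟩⟩

theorem IsWeightedCSeq.walkBound_subadditive (hC : IsWeightedCSeq C h o) {γ : Ordinal.{u}}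
    (hγ : γ < o) : ∀ α β, α ≤ β → β ≤ γ →
      (WalkBound C h n α β → WalkBound C h n β γ → WalkBound C h n α γ) ∧
      (WalkBound C h n α γ → WalkBound C h n β γ → WalkBound C h n α β) := by
  induction γ using WellFoundedLT.induction with
  | _ γ ih =>
  intro α β hαβ hβγ
  rcases hαβ.eq_or_lt with rfl | hαβ
  · exact ⟨fun _ h => h, fun _ _ => .refl _⟩
  rcases hβγ.eq_or_lt with rfl | hβγ
  · exact ⟨fun h _ => h, fun h _ => h⟩
  have ihβ := ih β hβγ (hβγ.trans hγ)
  by_cases hlim : ∃ μ ∈ limitPoints (C γ), α < μ ∧ μ ≤ β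
  -- The last limit point ν of C γ up to β equals β or is a tail point for β, so the bound at (β, γ)
  -- controls (ν, β). As γ may be replaced by ν over α, the claim reduces to α < ν ≤ β.
  · obtain ⟨μ, hμ, hαμ, hμβ⟩ := hlim
    obtain ⟨ν, hν, hνC, hμν, hνβ, hmax⟩ := hC.exists_last_limitPoint hγ hβγ hμ hμβ
    have hαν := hαμ.trans_le hμν
    have hiff := hC.walkBound_limitPoint_iff (n := n) hγ (hνβ.trans_lt hβγ) hν hαν
    have hνβw : WalkBound C h n β γ → WalkBound C h n ν β := fun hw => by
      rcases hνβ.eq_or_lt with rfl | hνβ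
      · exact .refl _
      · exact (hw.inv hβγ).2.2 ν ⟨hνC, hνβ, hmax⟩
    exact ⟨fun h1 h2 => hiff.2 ((ihβ α ν hαν.le hνβ).2 h1 (hνβw h2)),
      fun h1 h2 => (ihβ α ν hαν.le hνβ).1 (hiff.1 h1) (hνβw h2)⟩
  -- With no limit point in (α, β], tail points for α are tail points for β. The first step η from γ
  -- towards α is either below β, hence a tail point for β, or is also the first step towards β.
  · push Not at hlim
    have hle : ∀ μ ∈ limitPoints (C γ), μ ≤ β → μ ≤ α := fun μ hμ hμβ =>
      not_lt.1 fun hlt => (hlim μ hμ hlt).not_ge hμβ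
    constructor
    · intro h1 h2
      obtain ⟨hn, ⟨θ, hθ, hβθ, hθmin, hθw⟩, ht⟩ := h2.inv hβγ
      obtain ⟨η, hη, hαη, hmin⟩ := hC.exists_min hγ (hαβ.trans hβγ)
      refine .step (hαβ.trans hβγ) hn hη hαη hmin ?_ fun ξ hξ => ?_
      · rcases lt_or_ge η β with hηβ | hηβ
        · exact (ihβ α η hαη hηβ.le).2 h1
            (ht η ⟨hη, hηβ, fun μ hμ hμβ => (hle μ hμ hμβ).trans hαη⟩)
        · obtain rfl : η = θ := le_antisymm (hmin θ hθ (hαβ.le.trans hβθ)) (hθmin η hη hηβ)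
          have hηγ := hC.subset γ hγ hη
          exact (ih η hηγ (hηγ.trans hγ) α β hαβ.le hβθ).1 h1 hθw
      · exact (ihβ ξ α hξ.2.1.le hαβ.le).2 (ht ξ ⟨hξ.1, hξ.2.1.trans hαβ, fun μ hμ hμβ =>
          hξ.2.2 μ hμ (hle μ hμ hμβ)⟩) h1
    · intro h1 h2
      obtain ⟨-, ⟨θ, hθ, hβθ, hθmin, hθw⟩, ht⟩ := h2.inv hβγ
      obtain ⟨-, ⟨η, hη, hαη, hmin, hηw⟩, -⟩ := h1.inv (hαβ.trans hβγ)
      rcases lt_or_ge η β with hηβ | hηβ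
      · exact (ihβ α η hαη hηβ.le).1 hηw
          (ht η ⟨hη, hηβ, fun μ hμ hμβ => (hle μ hμ hμβ).trans hαη⟩)
      · obtain rfl : η = θ := le_antisymm (hmin θ hθ (hαβ.le.trans hβθ)) (hθmin η hη hηβ)
        have hηγ := hC.subset γ hγ hη
        exact (ih η hηγ (hηγ.trans hγ) α β hαβ.le hβθ).2 hηw hθw

/-- An infinite set of tail points would accumulate at some μ ≤ α above one of them. Finiteness
makes the maximum defining ρ a natural number. -/
theorem finite_setOf_isTailPoint (C : Ordinal.{u} → Set Ordinal.{u}) (γ α : Ordinal.{u}) :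
    {ξ | IsTailPoint C γ ξ α}.Finite := by
  by_contra hinf
  obtain ⟨μ, hμ, hμα, ξ, hξ, hξμ⟩ := exists_limitPoint_of_infinite hinf (α := α) fun ξ hξ => hξ.2.1
  exact hξμ.not_ge (hξ.2.2 μ (limitPoints_mono (fun _ h => h.1) hμ) hμα)

theorem IsWeightedCSeq.exists_walkBound (hC : IsWeightedCSeq C h o) {γ : Ordinal.{u}}
    (hγ : γ < o) : ∀ α ≤ γ, ∃ n, WalkBound C h n α γ := by
  induction γ using WellFoundedLT.induction with
  | _ γ ih =>
  intro α hα
  rcases hα.eq_or_lt with rfl | hα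
  · exact ⟨0, .refl _⟩
  obtain ⟨η, hη, hαη, hmin⟩ := hC.exists_min hγ hα
  have hηγ := hC.subset γ hγ hη
  obtain ⟨n, hn⟩ := ih η hηγ (hηγ.trans hγ) α hαη
  have hξ : ∀ ξ, ∃ n, IsTailPoint C γ ξ α → WalkBound C h n ξ α := fun ξ => by
    by_cases hξ : IsTailPoint C γ ξ α
    · obtain ⟨n, hn⟩ := ih α hα (hα.trans hγ) ξ hξ.2.1.le
      exact ⟨n, fun _ => hn⟩
    · exact ⟨0, fun h => absurd h hξ⟩
  choose f hf using hξ
  obtain ⟨m, hm⟩ := ((finite_setOf_isTailPoint C γ α).image f).bddAbove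
  exact ⟨max (h γ) (max n m), .step hα (le_max_left _ _) hη hαη hmin
    (hn.mono ((le_max_left _ _).trans (le_max_right _ _))) fun ξ hξ => (hf ξ hξ).mono
      ((hm ⟨ξ, hξ, rfl⟩).trans ((le_max_right _ _).trans (le_max_right _ _)))⟩

/-- Follow the walk from γ to β. Until it reaches β or a club having β as a limit point, the club
has a gap below β, so walks to nearby α < β take the same step. At the end the current weight, which
is at most n, equals h β. -/
theorem IsWeightedCSeq.weight_le_of_walkBound (hC : IsWeightedCSeq C h o) {A : Set Ordinal.{u}}
    {β : Ordinal.{u}} (hβ : β ∈ limitPoints A) {γ : Ordinal.{u}} (hγ : γ < o) (hβγ : β ≤ γ)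
    {ζ : Ordinal.{u}} (hζ : ζ < β) (hw : ∀ α ∈ A, ζ < α → α < β → WalkBound C h n α γ) :
    h β ≤ n := by
  induction γ using WellFoundedLT.induction generalizing ζ with
  | _ γ ih =>
  obtain ⟨α, hα, hζα, hαβ⟩ := hβ.2 ζ hζ
  have hinv := (hw α hα hζα hαβ).inv (hαβ.trans_le hβγ)
  rcases hβγ.eq_or_lt with rfl | hβγ
  · exact hinv.1
  by_cases hlim : β ∈ limitPoints (C γ)
  · exact (hC.weight γ hγ β hβγ hlim).trans_le hinv.1
  · have : ∃ ξ < β, ∀ δ ∈ C γ, ξ < δ → β ≤ δ := by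
      by_contra! hcon
      exact hlim ⟨hβ.1, fun ξ hξ => hcon ξ hξ⟩
    obtain ⟨ξ, hξ, hgap⟩ := this
    obtain ⟨η, hη, hβη, hmin⟩ := hC.exists_min hγ hβγ
    have hηγ := hC.subset γ hγ hη
    refine ih η hηγ (hηγ.trans hγ) hβη (max_lt hζ hξ) fun α hα hlt hαβ => ?_
    obtain ⟨-, ⟨θ, hθ, hαθ, hθmin, hθw⟩, -⟩ :=
      (hw α hα ((le_max_left _ _).trans_lt hlt) hαβ).inv (hαβ.trans hβγ)
    obtain rfl : θ = η := le_antisymm (hθmin η hη (hαβ.le.trans hβη))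
      (hmin θ hθ (hgap θ hθ (((le_max_right _ _).trans_lt hlt).trans_le hαθ)))
    exact hθw

theorem IsWeightedCSeq.exists_not_walkBound (hC : IsWeightedCSeq C h o)
    (hst : ∀ n, IsStationaryIn {β | n < h β} o) {A : Set Ordinal.{u}} (hA : IsUnboundedIn A o)
    (n : ℕ) : ∃ α ∈ A, ∃ β ∈ A, α < β ∧ ¬ WalkBound C h n α β := by
  by_contra! hcon
  obtain ⟨β, hβn, hβ, hβA⟩ := hst n A hA
  obtain ⟨γ, hγA, hβγ⟩ := hA.2 β hβ
  refine (hC.weight_le_of_walkBound hβA (hA.1 hγA) hβγ.le (pos_iff_ne_zero.2 hβA.1)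
    fun α hα _ hαβ => hcon α hα γ hγA (hαβ.trans hβγ)).not_gt hβn

end WalkBound

/-! ### Unbounded subadditive families of relations -/

/-- The relation `R i α β` abstracts `c (α, β) ≤ i` for a subadditive, strongly unbounded
`c : [o]² → ι`. -/
structure IsUnboundedSubadditive (R : Ordinal.{u} → Ordinal.{u} → Ordinal.{u} → Prop)
    (ι o : Ordinal.{u}) : Prop where
  mono : ∀ i j α β, i ≤ j → R i α β → R j α β
  total : ∀ α β, α < β → β < o → ∃ i < ι, R i α β
  trans : ∀ i α β γ, α < β → β < γ → γ < o → R i α β → R i β γ → R i α γ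
  tree : ∀ i α β γ, α < β → β < γ → γ < o → R i α γ → R i β γ → R i α β
  unbounded : ∀ A, IsUnboundedIn A o → ∀ i < ι, ∃ α ∈ A, ∃ β ∈ A, α < β ∧ ¬ R i α β

theorem exists_weightedCSeq_of_squarePrinciple {lam : Cardinal.{u}} (hreg : lam.IsRegular)
    (hunc : ℵ₀ < lam) (hsq : SquarePrinciple lam) :
    ∃ C h, IsWeightedCSeq C h lam.ord ∧ ∀ n, IsStationaryIn {β | n < h β} lam.ord := by
  obtain ⟨C, hC1, hC2, hthread⟩ := hsq
  obtain ⟨ζ, hζ, h, hh, hst⟩ := exists_coherent_coloring hreg hunc ⟨hC1, hC2⟩ hthread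
  classical
  -- The weights cohere only above ζ, so for γ > ζ the club is cut to lie above ζ, which removes its
  -- limit points up to ζ. Below, the weight is constantly 0.
  let E : Ordinal.{u} → Set Ordinal.{u} := fun γ =>
    if IsSuccLimit γ then (if ζ < γ then C γ ∩ Ioi ζ else C γ) else {ξ | succ ξ = γ}
  let w : Ordinal.{u} → ℕ := fun γ => if ζ < γ then h γ else 0
  have hlim : ∀ γ μ, μ ∈ limitPoints (E γ) → IsSuccLimit γ := fun γ μ hμ => by
    by_contra hγ
    have hE : E γ = {ξ | succ ξ = γ} := if_neg hγ
    rw [hE] at hμ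
    obtain ⟨δ, hδ, -, hδμ⟩ := hμ.2 0 (pos_iff_ne_zero.2 hμ.1)
    obtain ⟨δ', hδ', hlt, -⟩ := hμ.2 δ hδμ
    exact hlt.ne (succ_injective (hδ.trans hδ'.symm))
  have hE1 : ∀ γ, IsSuccLimit γ → ζ < γ → E γ = C γ ∩ Ioi ζ := fun γ h1 h2 => by
    simp only [E, if_pos h1, if_pos h2]
  have hE2 : ∀ γ, IsSuccLimit γ → ¬ ζ < γ → E γ = C γ := fun γ h1 h2 => by
    simp only [E, if_pos h1, if_neg h2]
  have hsub : ∀ γ, IsSuccLimit γ → E γ ⊆ C γ := fun γ h1 => by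
    by_cases h2 : ζ < γ
    · rw [hE1 γ h1 h2]; exact inter_subset_left
    · rw [hE2 γ h1 h2]
  have hgt : ∀ γ μ, ζ < γ → μ ∈ limitPoints (E γ) → ζ < μ := fun γ μ h2 hμ => by
    have h1 := hlim γ μ hμ
    rw [hE1 γ h1 h2] at hμ
    obtain ⟨δ, hδ, -, hlt⟩ := hμ.2 0 (pos_iff_ne_zero.2 hμ.1)
    exact lt_trans hδ.2 hlt
  refine ⟨E, w, ⟨fun γ hγ => ?_, fun γ hγ α hα => ?_, fun γ hγ μ hμγ hμ => ?_,
    fun γ hγ μ hμγ hμ => ?_, fun γ hγ μ hμγ hμ => ?_⟩, fun n A hA => ?_⟩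
  · by_cases h1 : IsSuccLimit γ
    · exact (hsub γ h1).trans (hC1 γ hγ h1).1
    · have hE : E γ = {ξ | succ ξ = γ} := if_neg h1
      rw [hE]
      rintro ξ rfl
      exact lt_succ ξ
  · by_cases h1 : IsSuccLimit γ
    · by_cases h2 : ζ < γ
      · obtain ⟨η, hη, hlt⟩ := (hC1 γ hγ h1).2.1 _ (max_lt hα h2)
        rw [hE1 γ h1 h2]
        exact ⟨η, ⟨hη, (le_max_right _ _).trans_lt hlt⟩, (le_max_left _ _).trans hlt.le⟩
      · obtain ⟨η, hη, hlt⟩ := (hC1 γ hγ h1).2.1 _ hα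
        rw [hE2 γ h1 h2]
        exact ⟨η, hη, hlt.le⟩
    · have hE : E γ = {ξ | succ ξ = γ} := if_neg h1
      rw [hE]
      rcases zero_or_succ_or_isSuccLimit γ with rfl | ⟨ξ, rfl⟩ | h
      · exact absurd hα (not_lt_zero)
      · exact ⟨ξ, rfl, lt_succ_iff.1 hα⟩
      · exact absurd h h1
  · have h1 := hlim γ μ hμ
    have hmem := (hC1 γ hγ h1).2.2 μ hμγ (limitPoints_mono (hsub γ h1) hμ)
    by_cases h2 : ζ < γ
    · rw [hE1 γ h1 h2]
      exact ⟨hmem, hgt γ μ h2 hμ⟩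
    · rwa [hE2 γ h1 h2]
  · have h1 := hlim γ μ hμ
    have hcoh := hC2 γ hγ h1 μ hμγ (limitPoints_mono (hsub γ h1) hμ)
    have h3 := isSuccLimit_of_mem_limitPoints hμ
    by_cases h2 : ζ < γ
    · rw [hE1 γ h1 h2, hE1 μ h3 (hgt γ μ h2 hμ), hcoh, inter_right_comm]
    · rw [hE2 γ h1 h2, hE2 μ h3 fun h => h2 (h.trans hμγ), hcoh]
  · have h1 := hlim γ μ hμ
    by_cases h2 : ζ < γ
    · have h4 := hgt γ μ h2 hμ
      simp only [w, if_pos h2, if_pos h4]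
      exact hh γ hγ h1 μ hμγ (limitPoints_mono (hsub γ h1) hμ) h4
    · simp only [w, if_neg h2, if_neg fun h => h2 (lt_trans h hμγ)]
  · obtain ⟨β, hβn, hβ, hβA, hζβ⟩ := exists_gt_of_isStationaryIn (hst n) hA hζ
    exact ⟨β, by simpa only [w, mem_ofPred_eq, if_pos hζβ] using hβn, hβ, hβA⟩

theorem exists_isUnboundedSubadditive_of_squarePrinciple {lam : Cardinal.{u}}
    (hreg : lam.IsRegular) (hunc : ℵ₀ < lam) (hsq : SquarePrinciple lam) :
    ∃ R, IsUnboundedSubadditive R (ord ℵ₀) lam.ord := by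
  obtain ⟨C, h, hC, hst⟩ := exists_weightedCSeq_of_squarePrinciple hreg hunc hsq
  refine ⟨fun i α β => ∃ n : ℕ, (n : Ordinal) ≤ i ∧ WalkBound C h n α β, ⟨?_, ?_, ?_, ?_, ?_⟩⟩
  · rintro i j α β hij ⟨n, hn, hw⟩
    exact ⟨n, hn.trans hij, hw⟩
  · intro α β hαβ hβ
    obtain ⟨n, hn⟩ := hC.exists_walkBound hβ α hαβ.le
    exact ⟨n, by simp, n, le_rfl, hn⟩
  · rintro i α β γ hαβ hβγ hγ ⟨n, hn, hw⟩ ⟨m, hm, hw'⟩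
    refine ⟨max n m, by rcases le_total n m with h | h <;> simpa [h],
      (hC.walkBound_subadditive hγ α β hαβ.le hβγ.le).1 (hw.mono (le_max_left _ _))
        (hw'.mono (le_max_right _ _))⟩
  · rintro i α β γ hαβ hβγ hγ ⟨n, hn, hw⟩ ⟨m, hm, hw'⟩
    refine ⟨max n m, by rcases le_total n m with h | h <;> simpa [h],
      (hC.walkBound_subadditive hγ α β hαβ.le hβγ.le).2 (hw.mono (le_max_left _ _))
        (hw'.mono (le_max_right _ _))⟩
  · intro A hA i hi
    obtain ⟨n, rfl⟩ := lt_omega0.1 (by simpa using hi : i < ω)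
    obtain ⟨α, hα, β, hβ, hlt, hn⟩ := hC.exists_not_walkBound hst hA n
    exact ⟨α, hα, β, hβ, hlt, fun ⟨m, hm, hw⟩ => hn (hw.mono (by exact_mod_cast hm))⟩

/-! ### Closing sets under a set-valued function -/

theorem zfset_card_iUnion_lt {κ : Cardinal.{u}} (hκ : κ.IsRegular) {ι : Type u} (hι : #ι < κ)
    {f : ι → ZFSet.{u}} (hf : ∀ i, (f i).card < κ) : (ZFSet.iUnion f).card < κ := by
  have h := ZFSet.lift_card_iUnion_le_sum_card (f := f)
  rw [Cardinal.lift_id] at h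
  exact h.trans_lt (sum_lt_of_isRegular hκ hι hf)

/-- The union of the sets `G a`, for `a ∈ A`. -/
noncomputable def biUnionSet (A : ZFSet.{u}) (G : ZFSet.{u} → ZFSet.{u}) : ZFSet.{u} :=
  ZFSet.iUnion fun a : Shrink.{u} A => G ((equivShrink A).symm a).1

theorem mem_biUnionSet {A : ZFSet.{u}} {G : ZFSet.{u} → ZFSet.{u}} {y : ZFSet.{u}} :
    y ∈ biUnionSet A G ↔ ∃ a ∈ A, y ∈ G a := by
  rw [biUnionSet, ZFSet.mem_iUnion]
  constructor
  · rintro ⟨i, hi⟩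
    exact ⟨_, ((equivShrink A).symm i).2, hi⟩
  · rintro ⟨a, ha, hy⟩
    exact ⟨equivShrink A ⟨a, ha⟩, by rwa [Equiv.symm_apply_apply]⟩

theorem card_biUnionSet_lt {κ : Cardinal.{u}} (hκ : κ.IsRegular) {A : ZFSet.{u}}
    (hA : A.card < κ) {G : ZFSet.{u} → ZFSet.{u}} (hG : ∀ a ∈ A, (G a).card < κ) :
    (biUnionSet A G).card < κ :=
  zfset_card_iUnion_lt hκ hA fun i => hG _ ((equivShrink A).symm i).2

theorem card_sUnion_lt {κ : Cardinal.{u}} (hκ : κ.IsRegular) {A : ZFSet.{u}}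
    (hA : A.card < κ) (hG : ∀ a ∈ A, a.card < κ) : (ZFSet.sUnion A).card < κ := by
  have : ZFSet.sUnion A = biUnionSet A id := by
    ext y
    simp [mem_biUnionSet]
  rw [this]
  exact card_biUnionSet_lt hκ hA hG

/-- `M` is closed under the set-valued function `G`. -/
def IsClosedUnder (G : ZFSet.{u} → ZFSet.{u}) (M : ZFSet.{u}) : Prop :=
  ∀ a ∈ M, G a ⊆ M

/-- The stages in closing `A` under `G`. -/
noncomputable def closureStage (G : ZFSet.{u} → ZFSet.{u}) (A : ZFSet.{u}) : ℕ → ZFSet.{u}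
  | 0 => A
  | n + 1 => biUnionSet (closureStage G A n) G

/-- The closure of `A` under the set-valued function `G`. -/
noncomputable def closureUnder (G : ZFSet.{u} → ZFSet.{u}) (A : ZFSet.{u}) : ZFSet.{u} :=
  ZFSet.iUnion fun n : ULift.{u} ℕ => closureStage G A n.down

section Closure

variable {G : ZFSet.{u} → ZFSet.{u}} {A B : ZFSet.{u}}

theorem mem_closureUnder {y : ZFSet.{u}} : y ∈ closureUnder G A ↔ ∃ n, y ∈ closureStage G A n := by
  rw [closureUnder, ZFSet.mem_iUnion]
  exact ⟨fun ⟨n, h⟩ => ⟨n.down, h⟩, fun ⟨n, h⟩ => ⟨⟨n⟩, h⟩⟩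

theorem subset_closureUnder : A ⊆ closureUnder G A := fun _ hy => mem_closureUnder.2 ⟨0, hy⟩

theorem isClosedUnder_closureUnder : IsClosedUnder G (closureUnder G A) := fun a ha y hy => by
  obtain ⟨n, hn⟩ := mem_closureUnder.1 ha
  exact mem_closureUnder.2 ⟨n + 1, mem_biUnionSet.2 ⟨a, hn, hy⟩⟩

theorem closureUnder_induction {p : ZFSet.{u} → Prop} (h0 : ∀ y ∈ A, p y)
    (h1 : ∀ a, p a → ∀ y ∈ G a, p y) : ∀ y ∈ closureUnder G A, p y := by
  have : ∀ n, ∀ y ∈ closureStage G A n, p y := fun n => by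
    induction n with
    | zero => exact h0
    | succ n ih =>
      intro y hy
      obtain ⟨a, ha, hy⟩ := mem_biUnionSet.1 hy
      exact h1 a (ih a ha) y hy
  intro y hy
  obtain ⟨n, hn⟩ := mem_closureUnder.1 hy
  exact this n y hn

theorem closureUnder_subset (h0 : A ⊆ B) (h1 : IsClosedUnder G B) : closureUnder G A ⊆ B :=
  fun y hy => closureUnder_induction (p := (· ∈ B)) (fun _ h => h0 h)
    (fun a ha _ h => h1 a ha h) y hy

theorem card_closureUnder_lt {κ : Cardinal.{u}} (hκ : κ.IsRegular) (hunc : ℵ₀ < κ)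
    (hA : A.card < κ) (hG : ∀ a, (G a).card < κ) : (closureUnder G A).card < κ := by
  refine zfset_card_iUnion_lt hκ (by simpa using hunc) fun n => ?_
  have : ∀ n, (closureStage G A n).card < κ := fun n => by
    induction n with
    | zero => exact hA
    | succ n ih => exact card_biUnionSet_lt hκ ih fun a _ => hG a
  exact this _

theorem closureUnder_mem_smallSubsets {κ : Cardinal.{u}} (hκ : κ.IsRegular) (hunc : ℵ₀ < κ)
    {X : Set ZFSet.{u}} (hA : A ∈ smallSubsets κ X) (hG : ∀ a, G a ∈ smallSubsets κ X) :
    closureUnder G A ∈ smallSubsets κ X :=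
  ⟨closureUnder_induction hA.1 fun a _ => (hG a).1,
    card_closureUnder_lt hκ hunc hA.2 fun a => (hG a).2⟩

/-- Because `G` takes one argument, closure passes to arbitrary unions, directed or not. This is why
`IsRich` demands only unary closure. -/
theorem isStrongClub_isClosedUnder {κ : Cardinal.{u}} (hκ : κ.IsRegular) (hunc : ℵ₀ < κ)
    {X : Set ZFSet.{u}} (hG : ∀ a, G a ∈ smallSubsets κ X) :
    IsStrongClub κ X {M | M ∈ smallSubsets κ X ∧ IsClosedUnder G M} := by
  refine ⟨⟨fun M hM => hM.1, fun M hM => ⟨closureUnder G M,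
    ⟨closureUnder_mem_smallSubsets hκ hunc hM hG, isClosedUnder_closureUnder⟩,
    subset_closureUnder⟩⟩, fun D _ hD hcard => ⟨⟨fun y hy => ?_, ?_⟩, fun a ha y hy => ?_⟩⟩
  · obtain ⟨M, hM, hy⟩ := ZFSet.mem_sUnion.1 hy
    exact (hD M hM).1.1 y hy
  · exact card_sUnion_lt hκ hcard fun M hM => (hD M hM).1.2
  · obtain ⟨M, hM, ha⟩ := ZFSet.mem_sUnion.1 ha
    exact ZFSet.mem_sUnion.2 ⟨M, hM, (hD M hM).2 a ha hy⟩

end Closure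

/-! ### Sets whose ordinals are boundedly directed -/

/-- Every family of at most `χ` ordinals of `N ∩ o` has a strict upper bound in `N ∩ o`. -/
def IsOrdinalDirected (χ : Cardinal.{u}) (o : Ordinal.{u}) (N : ZFSet.{u}) : Prop :=
  ∀ g : Ordinal.{u} → Ordinal.{u}, (∀ j < χ.ord, g j < o ∧ (g j).toZFSet ∈ N) →
    ∃ s < o, s.toZFSet ∈ N ∧ ∀ j < χ.ord, g j < s

section Directed

variable {χ κ lam : Cardinal.{u}}

theorem mem_hereditary_of_subset_toZFSet {y : ZFSet.{u}} (hy : y ⊆ lam.ord.toZFSet) :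
    y ∈ hereditary (succ lam) :=
  ⟨lam.ord.toZFSet, (ZFSet.isOrdinal_toZFSet _).isTransitive, hy, by simp⟩

/-- The set of all `f η` with `η < ξ`. -/
noncomputable def imageBelow (f : Ordinal.{u} → ZFSet.{u}) (ξ : Ordinal.{u}) : ZFSet.{u} :=
  ZFSet.range fun η : Iio ξ => f η.1

theorem mem_imageBelow {f : Ordinal.{u} → ZFSet.{u}} {ξ : Ordinal.{u}} {y : ZFSet.{u}} :
    y ∈ imageBelow f ξ ↔ ∃ η < ξ, f η = y := by
  simp [imageBelow]

theorem card_imageBelow_le (f : Ordinal.{u} → ZFSet.{u}) (ξ : Ordinal.{u}) :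
    (imageBelow f ξ).card ≤ ξ.card := by
  have h := ZFSet.lift_card_range_le (f := fun η : Iio ξ => f η.1)
  rw [Cardinal.mk_Iio_ordinal, Cardinal.lift_lift] at h
  exact Cardinal.lift_le.1 h

/-- A sequence of ordinals, each chosen by `b` from the closure of `A` and the previous ones. -/
noncomputable def directedSeq (G : ZFSet.{u} → ZFSet.{u}) (A : ZFSet.{u})
    (b : ZFSet.{u} → Ordinal.{u}) (ξ : Ordinal.{u}) : Ordinal.{u} :=
  b (closureUnder G (A ∪ ZFSet.range fun η : Iio ξ => (directedSeq G A b η.1).toZFSet))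
termination_by ξ
decreasing_by exact η.2

theorem directedSeq_eq (G : ZFSet.{u} → ZFSet.{u}) (A : ZFSet.{u})
    (b : ZFSet.{u} → Ordinal.{u}) (ξ : Ordinal.{u}) :
    directedSeq G A b ξ =
      b (closureUnder G (A ∪ imageBelow (fun η => (directedSeq G A b η).toZFSet) ξ)) := by
  rw [directedSeq]
  rfl

/-- Take χ⁺ stages, each adding an ordinal σ ξ above all ordinals of stage ξ. By regularity of χ⁺,
any χ ordinals of the union appear by one stage ξ, and σ ξ bounds them; the union is small since χ⁺
< κ. -/
theorem exists_closed_directed (hχ : ℵ₀ ≤ χ) (hχκ : succ χ < κ) (hκlam : κ ≤ lam)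
    (hκ : κ.IsRegular) (hcof : κ ≤ lam.ord.cof) {G : ZFSet.{u} → ZFSet.{u}}
    (hG : ∀ a, G a ∈ smallSubsets κ (hereditary (succ lam))) {A : ZFSet.{u}}
    (hA : A ∈ smallSubsets κ (hereditary (succ lam))) :
    ∃ N ∈ smallSubsets κ (hereditary (succ lam)), A ⊆ N ∧ IsClosedUnder G N ∧
      IsOrdinalDirected χ lam.ord N := by
  have hunc : ℵ₀ < κ := hχ.trans_lt ((lt_succ χ).trans hχκ)
  have hlam : ℵ₀ ≤ lam := hunc.le.trans hκlam
  have hb : ∀ a : ZFSet.{u}, ∃ s < lam.ord, a.card < κ →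
      ∀ α < lam.ord, α.toZFSet ∈ a → α < s := fun a => by
    by_cases h : a.card < κ
    · obtain ⟨s, hs, hs'⟩ := exists_strict_bound_of_zfset_card_lt_cof (h.trans_le hcof)
      exact ⟨s, hs, fun _ => hs'⟩
    · exact ⟨0, (isSuccLimit_ord hlam).bot_lt, fun h' => absurd h' h⟩
  choose b hb hb' using hb
  set σ := directedSeq G A b
  set N : Ordinal.{u} → ZFSet.{u} := fun ξ =>
    closureUnder G (A ∪ imageBelow (fun η => (σ η).toZFSet) ξ)
  have hσN : ∀ ξ, σ ξ = b (N ξ) := directedSeq_eq G A b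
  have hσlt : ∀ ξ, σ ξ < lam.ord := fun ξ => hσN ξ ▸ hb _
  have hsmall : ∀ ξ ≤ (succ χ).ord, N ξ ∈ smallSubsets κ (hereditary (succ lam)) := fun ξ hξ => by
    refine closureUnder_mem_smallSubsets hκ hunc ⟨fun y hy => ?_, ?_⟩ hG
    · rcases ZFSet.mem_union.1 hy with hy | hy
      · exact hA.1 y hy
      · obtain ⟨η, -, rfl⟩ := mem_imageBelow.1 hy
        exact mem_hereditary_of_subset_toZFSet (Ordinal.toZFSet_subset_toZFSet_iff.2 (hσlt η).le)
    · refine ZFSet.card_union_le.trans_lt (add_lt_of_lt hκ.aleph0_le hA.2 ?_)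
      refine (card_imageBelow_le _ ξ).trans_lt (lt_of_le_of_lt ?_ hχκ)
      simpa using card_le_card hξ
  have hlim : IsSuccLimit (succ χ).ord := isSuccLimit_ord (hχ.trans (le_succ χ))
  have hstage : ∀ y ∈ N (succ χ).ord, ∃ ξ < (succ χ).ord, y ∈ N ξ := by
    refine closureUnder_induction (fun y hy => ?_) fun a ha y hy => ?_
    · rcases ZFSet.mem_union.1 hy with hy | hy
      · exact ⟨0, hlim.bot_lt, subset_closureUnder (ZFSet.mem_union.2 (Or.inl hy))⟩
      · obtain ⟨η, hη, rfl⟩ := mem_imageBelow.1 hy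
        exact ⟨succ η, hlim.succ_lt hη, subset_closureUnder (ZFSet.mem_union.2 (Or.inr
          (mem_imageBelow.2 ⟨η, lt_succ η, rfl⟩)))⟩
    · obtain ⟨ξ, hξ, haξ⟩ := ha
      exact ⟨ξ, hξ, isClosedUnder_closureUnder a haξ hy⟩
  have hmono : ∀ ξ ξ', ξ ≤ ξ' → N ξ ⊆ N ξ' := fun ξ ξ' h => by
    refine closureUnder_subset (fun y hy => subset_closureUnder ?_) isClosedUnder_closureUnder
    rcases ZFSet.mem_union.1 hy with hy | hy
    · exact ZFSet.mem_union.2 (Or.inl hy)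
    · obtain ⟨η, hη, rfl⟩ := mem_imageBelow.1 hy
      exact ZFSet.mem_union.2 (Or.inr (mem_imageBelow.2 ⟨η, hη.trans_le h, rfl⟩))
  refine ⟨N (succ χ).ord, hsmall _ le_rfl, fun y hy => subset_closureUnder
    (ZFSet.mem_union.2 (Or.inl hy)), isClosedUnder_closureUnder, fun g hg => ?_⟩
  have h1 : ∀ j, ∃ ξ, j < χ.ord → ξ < (succ χ).ord ∧ (g j).toZFSet ∈ N ξ := fun j => by
    by_cases hj : j < χ.ord
    · obtain ⟨ξ, h1, h2⟩ := hstage _ (hg j hj).2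
      exact ⟨ξ, fun _ => ⟨h1, h2⟩⟩
    · exact ⟨0, fun h => absurd h hj⟩
  choose f hf using h1
  obtain ⟨ξ, hξ, hfξ⟩ := exists_strict_bound_of_card_lt_cof (ι := χ.ord) (δ := (succ χ).ord)
    (by rw [(isRegular_succ hχ).cof_ord, card_ord]; exact lt_succ χ) fun j hj => (hf j hj).1
  refine ⟨σ ξ, hσlt ξ, subset_closureUnder (ZFSet.mem_union.2 (Or.inr
    (mem_imageBelow.2 ⟨ξ, hξ, rfl⟩))), fun j hj => ?_⟩
  rw [hσN]
  exact hb' _ (hsmall ξ hξ.le).2 _ (hg j hj).1 (hmono _ _ (hfξ j hj).le (hf j hj).2)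

end Directed

/-! ### Coding pairs of ordinals -/

section Coding

variable {χ lam : Cardinal.{u}}

/-- The ordinal coding the pair `(j, α)`, for `j < χ`. -/
noncomputable def pairCode (χ : Cardinal.{u}) (j α : Ordinal.{u}) : Ordinal.{u} :=
  χ.ord * α + j

theorem pairCode_lt (hχ : ℵ₀ ≤ χ) (hlam : χ < lam) {j α : Ordinal.{u}} (hj : j < χ.ord)
    (hα : α < lam.ord) : pairCode χ j α < lam.ord :=
  have h := hχ.trans hlam.le
  isPrincipal_add_ord h (isPrincipal_mul_ord h (ord_lt_ord.2 hlam) hα) (hj.trans (ord_lt_ord.2 hlam))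

theorem pairCode_inj {i j α β : Ordinal.{u}} (hi : i < χ.ord) (hj : j < χ.ord)
    (h : pairCode χ i α = pairCode χ j β) : i = j ∧ α = β := by
  have h0 : χ.ord ≠ 0 := (pos_of_gt hi).ne'
  have h1 := congrArg (· / χ.ord) h
  have h2 := congrArg (· % χ.ord) h
  simp only [pairCode, Ordinal.mul_add_div _ h0, Ordinal.div_eq_zero_of_lt hi,
    Ordinal.div_eq_zero_of_lt hj, add_zero, Ordinal.mul_add_mod_self, Ordinal.mod_eq_of_lt hi,
    Ordinal.mod_eq_of_lt hj] at h1 h2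
  exact ⟨h2, h1⟩

theorem le_pairCode (hχ : ℵ₀ ≤ χ) (j α : Ordinal.{u}) : α ≤ pairCode χ j α :=
  (Ordinal.le_mul_right α (isSuccLimit_ord hχ).bot_lt).trans le_self_add

variable {R : Ordinal.{u} → Ordinal.{u} → Ordinal.{u} → Prop}

/-- The codes of the pairs `(j, α)` with `i ≤ j`, `α < β` and `R j α β`. -/
noncomputable def relationCode (R : Ordinal.{u} → Ordinal.{u} → Ordinal.{u} → Prop)
    (χ lam : Cardinal.{u}) (i β : Ordinal.{u}) : ZFSet.{u} :=
  ZFSet.sep (fun y => ∃ j α, i ≤ j ∧ j < χ.ord ∧ α < β ∧ R j α β ∧ (pairCode χ j α).toZFSet = y)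
    lam.ord.toZFSet

theorem relationCode_subset (i β : Ordinal.{u}) : relationCode R χ lam i β ⊆ lam.ord.toZFSet :=
  fun _ hy => (ZFSet.mem_sep.1 hy).1

theorem pairCode_mem_relationCode (hχ : ℵ₀ ≤ χ) (hlam : χ < lam) {i j α β : Ordinal.{u}}
    (hj : j < χ.ord) (hα : α < lam.ord) :
    (pairCode χ j α).toZFSet ∈ relationCode R χ lam i β ↔ i ≤ j ∧ α < β ∧ R j α β := by
  rw [relationCode, ZFSet.mem_sep]
  constructor
  · rintro ⟨-, j', α', h1, h2, h3, h4, h5⟩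
    obtain ⟨rfl, rfl⟩ := pairCode_inj h2 hj (toZFSet_injective h5)
    exact ⟨h1, h3, h4⟩
  · rintro ⟨h1, h2, h3⟩
    exact ⟨toZFSet_mem_toZFSet_iff.2 (pairCode_lt hχ hlam hj hα), j, α, h1, hj, h2, h3, rfl⟩

/-- The closure properties of `M` that stand in for elementarity in the guessing argument. -/
structure IsRich (R : Ordinal.{u} → Ordinal.{u} → Ordinal.{u} → Prop) (χ κ lam : Cardinal.{u})
    (M : ZFSet.{u}) : Prop where
  bound : ∀ a ∈ M, a.card < κ →
    ∃ s < lam.ord, s.toZFSet ∈ M ∧ ∀ α < lam.ord, α.toZFSet ∈ a → α < s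
  succ_mem : ∀ β < lam.ord, β.toZFSet ∈ M → (succ β).toZFSet ∈ M
  pairCode_mem : ∀ β < lam.ord, β.toZFSet ∈ M → ∀ j < χ.ord, (pairCode χ j β).toZFSet ∈ M
  relationCode_mem : ∀ β < lam.ord, β.toZFSet ∈ M → ∀ i < χ.ord, relationCode R χ lam i β ∈ M
  witness : ∀ a ∈ M, ∀ j < χ.ord, ∃ u < lam.ord, u.toZFSet ∈ M ∧
    ((∀ α < lam.ord, (pairCode χ j α).toZFSet ∈ a → α < u) ∨
      ∃ v < lam.ord, v.toZFSet ∈ M ∧ u < v ∧ (pairCode χ j u).toZFSet ∈ a ∧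
        (pairCode χ j v).toZFSet ∈ a ∧ ¬ R j u v)

theorem exists_isRich_of_isClosedUnder {κ : Cardinal.{u}} (hχ : ℵ₀ ≤ χ) (hχκ : χ < κ)
    (hκlam : κ ≤ lam) (hκ : κ.IsRegular) (hcof : κ ≤ lam.ord.cof)
    (hR : IsUnboundedSubadditive R χ.ord lam.ord) :
    ∃ G : ZFSet.{u} → ZFSet.{u}, (∀ a, G a ∈ smallSubsets κ (hereditary (succ lam))) ∧
      ∀ M, IsClosedUnder G M → IsRich R χ κ lam M := by
  have hχlam : χ < lam := hχκ.trans_le hκlam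
  have hlim : IsSuccLimit lam.ord := isSuccLimit_ord (hχ.trans hχlam.le)
  have hb : ∀ a : ZFSet.{u}, ∃ s < lam.ord, a.card < κ →
      ∀ α < lam.ord, α.toZFSet ∈ a → α < s := fun a => by
    by_cases h : a.card < κ
    · obtain ⟨s, hs, hs'⟩ := exists_strict_bound_of_zfset_card_lt_cof (h.trans_le hcof)
      exact ⟨s, hs, fun _ => hs'⟩
    · exact ⟨0, hlim.bot_lt, fun h' => absurd h' h⟩
  have hw : ∀ (a : ZFSet.{u}) (j : Ordinal.{u}), ∃ u < lam.ord, ∃ v < lam.ord, j < χ.ord →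
      ((∀ α < lam.ord, (pairCode χ j α).toZFSet ∈ a → α < u) ∨
        u < v ∧ (pairCode χ j u).toZFSet ∈ a ∧ (pairCode χ j v).toZFSet ∈ a ∧ ¬ R j u v) := by
    intro a j
    by_cases hj : j < χ.ord
    · by_cases hbd : ∃ u < lam.ord, ∀ α < lam.ord, (pairCode χ j α).toZFSet ∈ a → α < u
      · obtain ⟨u, hu, h⟩ := hbd
        exact ⟨u, hu, u, hu, fun _ => Or.inl h⟩
      · push Not at hbd
        obtain ⟨u, ⟨hu, hua⟩, v, ⟨hv, hva⟩, huv, hn⟩ := hR.unbounded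
          {α | α < lam.ord ∧ (pairCode χ j α).toZFSet ∈ a} ⟨fun _ h => h.1, fun γ hγ => by
            obtain ⟨α, hα, hαa, hle⟩ := hbd _ (hlim.succ_lt hγ)
            exact ⟨α, ⟨hα, hαa⟩, succ_le_iff.1 hle⟩⟩ j hj
        exact ⟨u, hu, v, hv, fun _ => Or.inr ⟨huv, hua, hva, hn⟩⟩
    · exact ⟨0, hlim.bot_lt, 0, hlim.bot_lt, fun h => absurd h hj⟩
  choose b hb hb' using hb
  choose U hU V hV hUV using hw
  -- The rank recovers β from its von Neumann ordinal; other arguments only need some value below λ.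
  let r : ZFSet.{u} → Ordinal.{u} := fun a => if a.rank < lam.ord then a.rank else 0
  have hr : ∀ a, r a < lam.ord := fun a => by
    by_cases h : a.rank < lam.ord
    · simp [r, h]
    · simpa [r, h] using hlim.bot_lt
  have hr' : ∀ β < lam.ord, r β.toZFSet = β := fun β hβ => by simp [r, hβ]
  -- Single values are written as images of constant functions on χ, so that all six pieces share
  -- the index j < χ.
  let G : ZFSet.{u} → ZFSet.{u} := fun a =>
    imageBelow (fun _ => (b a).toZFSet) χ.ord ∪ (imageBelow (fun _ => (succ (r a)).toZFSet) χ.ord ∪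
    (imageBelow (fun j => (pairCode χ j (r a)).toZFSet) χ.ord ∪
    (imageBelow (fun i => relationCode R χ lam i (r a)) χ.ord ∪
    (imageBelow (fun j => (U a j).toZFSet) χ.ord ∪ imageBelow (fun j => (V a j).toZFSet) χ.ord))))
  have hG : ∀ a y, y ∈ G a ↔ ∃ j < χ.ord, (b a).toZFSet = y ∨ (succ (r a)).toZFSet = y ∨
      (pairCode χ j (r a)).toZFSet = y ∨ relationCode R χ lam j (r a) = y ∨
      (U a j).toZFSet = y ∨ (V a j).toZFSet = y := fun a y => by
    simp only [G, ZFSet.mem_union, mem_imageBelow, ← exists_or, ← and_or_left]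
  have h0 : 0 < χ.ord := (isSuccLimit_ord hχ).bot_lt
  refine ⟨G, fun a => ⟨fun y hy => mem_hereditary_of_subset_toZFSet ?_, ?_⟩,
    fun M hM => ⟨?_, ?_, ?_, ?_, ?_⟩⟩
  · have hlt : ∀ α < lam.ord, α.toZFSet ⊆ lam.ord.toZFSet := fun α hα =>
      Ordinal.toZFSet_subset_toZFSet_iff.2 hα.le
    obtain ⟨j, hj, rfl | rfl | rfl | rfl | rfl | rfl⟩ := (hG a y).1 hy
    · exact hlt _ (hb a)
    · exact hlt _ (hlim.succ_lt (hr a))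
    · exact hlt _ (pairCode_lt hχ hχlam hj (hr a))
    · exact relationCode_subset _ _
    · exact hlt _ (hU a j)
    · exact hlt _ (hV a j)
  · have hU : ∀ x y : ZFSet.{u}, x.card < κ → y.card < κ → (x ∪ y).card < κ := fun x y hx hy =>
      ZFSet.card_union_le.trans_lt (add_lt_of_lt hκ.aleph0_le hx hy)
    have hI : ∀ f, (imageBelow f χ.ord).card < κ := fun f =>
      (card_imageBelow_le f _).trans_lt (by rwa [card_ord])
    exact hU _ _ (hI _) (hU _ _ (hI _) (hU _ _ (hI _) (hU _ _ (hI _) (hU _ _ (hI _) (hI _)))))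
  · exact fun a ha hcard => ⟨b a, hb a, hM a ha ((hG a _).2 ⟨0, h0, by simp⟩), hb' a hcard⟩
  · exact fun β hβ hβM => hM _ hβM ((hG _ _).2 ⟨0, h0, by simp [hr' β hβ]⟩)
  · exact fun β hβ hβM j hj => hM _ hβM ((hG _ _).2 ⟨j, hj, by simp [hr' β hβ]⟩)
  · exact fun β hβ hβM j hj => hM _ hβM ((hG _ _).2 ⟨j, hj, by simp [hr' β hβ]⟩)
  · intro a ha j hj
    refine ⟨U a j, hU a j, hM a ha ((hG a _).2 ⟨j, hj, by simp⟩), (hUV a j hj).imp_right ?_⟩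
    exact fun h => ⟨V a j, hV a j, hM a ha ((hG a _).2 ⟨j, hj, by simp⟩), h⟩

end Coding

/-! ### Guessing excludes unbounded subadditive families -/

section Guessing

variable {χ κ lam : Cardinal.{u}} {R : Ordinal.{u} → Ordinal.{u} → Ordinal.{u} → Prop}

theorem le_supBelow {M : ZFSet.{u}} {α : Ordinal.{u}} (hα : α < lam.ord) (hM : α.toZFSet ∈ M) :
    α ≤ supBelow M lam :=
  le_csSup ⟨lam.ord, fun _ h => h.1.le⟩ ⟨hα, hM⟩

theorem exists_gt_of_lt_supBelow {M : ZFSet.{u}} {γ : Ordinal.{u}} (h : γ < supBelow M lam) :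
    ∃ α < lam.ord, α.toZFSet ∈ M ∧ γ < α := by
  by_contra! hcon
  exact h.not_ge (csSup_le' fun α hα => hcon α hα.1 hα.2)

theorem supBelow_lt (hcof : κ ≤ lam.ord.cof) {M : ZFSet.{u}} (hM : M.card < κ) :
    supBelow M lam < lam.ord := by
  obtain ⟨s, hs, h⟩ := exists_strict_bound_of_zfset_card_lt_cof (hM.trans_le hcof)
  exact (csSup_le' fun α hα => (h α hα.1 hα.2).le).trans_lt hs

theorem IsRich.lt_supBelow (hlim : IsSuccLimit lam.ord) {M : ZFSet.{u}}
    (hM : IsRich R χ κ lam M) {α : Ordinal.{u}} (hα : α < lam.ord) (hαM : α.toZFSet ∈ M) :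
    α < supBelow M lam :=
  (lt_succ α).trans_le (le_supBelow (hlim.succ_lt hα) (hM.succ_mem α hα hαM))

/-- Otherwise each i < χ fails beyond some γ below the supremum; these χ bounds are bounded below it
by cofinality, and an element of M above them has no index. -/
theorem IsRich.exists_unbounded_index (hlim : IsSuccLimit lam.ord)
    (hR : IsUnboundedSubadditive R χ.ord lam.ord) {M : ZFSet.{u}} (hM : IsRich R χ κ lam M)
    (hlt : supBelow M lam < lam.ord) (hcof : χ < (supBelow M lam).cof) :
    ∃ i < χ.ord, ∀ γ < supBelow M lam, ∃ β < lam.ord, β.toZFSet ∈ M ∧ γ < β ∧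
      R i β (supBelow M lam) := by
  by_contra! hcon
  have h1 : ∀ i, ∃ γ, i < χ.ord → γ < supBelow M lam ∧ ∀ β < lam.ord, β.toZFSet ∈ M → γ < β →
      ¬ R i β (supBelow M lam) := fun i => by
    by_cases hi : i < χ.ord
    · obtain ⟨γ, h⟩ := hcon i hi
      exact ⟨γ, fun _ => h⟩
    · exact ⟨0, fun h => absurd h hi⟩
  choose g hg using h1
  obtain ⟨s, hs, hgs⟩ := exists_strict_bound_of_card_lt_cof (ι := χ.ord) (f := g)
    (by rwa [card_ord]) fun i hi => (hg i hi).1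
  obtain ⟨β, hβ, hβM, hsβ⟩ := exists_gt_of_lt_supBelow hs
  obtain ⟨i, hi, hw⟩ := hR.total β _ (hM.lt_supBelow hlim hβ hβM) hlt
  exact (hg i hi).2 β hβ hβM ((hgs i hi).trans hsβ) hw

/-- A small z ∈ M has its ordinals, hence the second coordinates it codes, bounded below some β ∈ M
with `R i β δ`, where δ is the supremum. For j ≥ i the inequalities `trans` and `tree` make level j
of β and of δ agree there; lower levels are left out of the code because this fails for them. -/
theorem IsRich.isApproximated (hχ : ℵ₀ ≤ χ) (hχlam : χ < lam)
    (hR : IsUnboundedSubadditive R χ.ord lam.ord) {M : ZFSet.{u}} (hM : IsRich R χ κ lam M)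
    (hlt : supBelow M lam < lam.ord) {i : Ordinal.{u}} (hi : i < χ.ord)
    (hunb : ∀ γ < supBelow M lam, ∃ β < lam.ord, β.toZFSet ∈ M ∧ γ < β ∧
      R i β (supBelow M lam)) :
    IsApproximated κ M lam.ord.toZFSet (relationCode R χ lam i (supBelow M lam)) := by
  have hlim : IsSuccLimit lam.ord := isSuccLimit_ord (hχ.trans hχlam.le)
  intro z hz _ hcard
  obtain ⟨s, hs, hsM, hsz⟩ := hM.bound z hz hcard
  obtain ⟨β, hβ, hβM, hsβ, hw⟩ := hunb s (hM.lt_supBelow hlim hs hsM)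
  have hβδ := hM.lt_supBelow hlim hβ hβM
  refine ⟨_, hM.relationCode_mem β hβ hβM i hi, ?_⟩
  have key : ∀ j α, j < χ.ord → α < lam.ord → (pairCode χ j α).toZFSet ∈ z →
      ((pairCode χ j α).toZFSet ∈ relationCode R χ lam i (supBelow M lam) ↔
        (pairCode χ j α).toZFSet ∈ relationCode R χ lam i β) := by
    intro j α hj hα hz
    have hαβ : α < β :=
      ((le_pairCode hχ j α).trans_lt (hsz _ (pairCode_lt hχ hχlam hj hα) hz)).trans hsβ
    rw [pairCode_mem_relationCode hχ hχlam hj hα, pairCode_mem_relationCode hχ hχlam hj hα]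
    refine and_congr_right fun hij => ?_
    have hw' := hR.mono i j _ _ hij hw
    exact ⟨fun h => ⟨hαβ, hR.tree j α β _ hαβ hβδ hlt h.2 hw'⟩,
      fun h => ⟨hαβ.trans hβδ, hR.trans j α β _ hαβ hβδ hlt h.2 hw'⟩⟩
  ext y
  simp only [ZFSet.mem_inter, and_congr_left_iff]
  intro hyz
  constructor
  · intro hy
    obtain ⟨-, j, α, -, hj, hα, -, rfl⟩ := ZFSet.mem_sep.1 hy
    exact (key j α hj (hα.trans hlt) hyz).1 hy
  · intro hy
    obtain ⟨-, j, α, -, hj, hα, -, rfl⟩ := ZFSet.mem_sep.1 hy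
    exact (key j α hj (hα.trans hβ) hyz).2 hy

theorem IsRich.not_isGuessed (hχ : ℵ₀ ≤ χ) (hχlam : χ < lam)
    (hR : IsUnboundedSubadditive R χ.ord lam.ord) {N : ZFSet.{u}} (hN : IsRich R χ κ lam N)
    (hdir : IsOrdinalDirected χ lam.ord N) {i δ : Ordinal.{u}} (hi : i < χ.ord)
    (hδ : δ < lam.ord) (hNδ : ∀ α < lam.ord, α.toZFSet ∈ N → α < δ) :
    ¬ IsGuessed N (relationCode R χ lam i δ) := by
  rintro ⟨e, he, heq⟩
  have hmem : ∀ j < χ.ord, ∀ α < lam.ord, α.toZFSet ∈ N →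
      ((pairCode χ j α).toZFSet ∈ e ↔ i ≤ j ∧ α < δ ∧ R j α δ) := fun j hj α hα hαN => by
    have hpN := hN.pairCode_mem α hα hαN j hj
    rw [← pairCode_mem_relationCode hχ hχlam hj hα (R := R)]
    have h : (pairCode χ j α).toZFSet ∈ relationCode R χ lam i δ ∩ N ↔
        (pairCode χ j α).toZFSet ∈ e ∩ N := by rw [heq]
    simpa [hpN] using h.symm
  have hwit := hN.witness e he
  choose! U hU hUN hUe using hwit
  -- The level of s below δ is not known in advance, so s must exceed the witnesses for all χ slices
  -- at once.
  obtain ⟨s, hs, hsN, hUs⟩ := hdir U fun j hj => ⟨hU j hj, hUN j hj⟩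
  obtain ⟨j, hj, hw⟩ := hR.total s δ (hNδ s hs hsN) hδ
  have hk : max i j < χ.ord := max_lt hi hj
  have hse := (hmem _ hk s hs hsN).2 ⟨le_max_left _ _, hNδ s hs hsN,
    hR.mono _ _ _ _ (le_max_right _ _) hw⟩
  rcases hUe _ hk with hbd | ⟨v, hv, hvN, huv, hue, hve, hn⟩
  · exact (hbd s hs hse).not_gt (hUs _ hk)
  · have h1 := (hmem _ hk _ (hU _ hk) (hUN _ hk)).1 hue
    have h2 := (hmem _ hk _ hv hvN).1 hve
    exact hn (hR.tree _ _ _ _ huv h2.2.1 hδ h1.2.2 h2.2.2)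

theorem not_isUnboundedSubadditive_of_WAGP (hχ : ℵ₀ ≤ χ) (hχκ : succ χ < κ) (hκlam : κ ≤ lam)
    (hκ : κ.IsRegular) (hcof : κ ≤ lam.ord.cof)
    (hAGP : WAGP (largeCofinality χ κ lam) κ κ (succ lam)) :
    ¬ IsUnboundedSubadditive R χ.ord lam.ord := by
  intro hR
  have hχκ' : χ < κ := (lt_succ χ).trans hχκ
  have hχlam : χ < lam := hχκ'.trans_le hκlam
  have hunc : ℵ₀ < κ := hχ.trans_lt hχκ'
  have hlim : IsSuccLimit lam.ord := isSuccLimit_ord (hχ.trans hχlam.le)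
  obtain ⟨G, hG, hrich⟩ := exists_isRich_of_isClosedUnder hχ hχκ' hκlam hκ hcof hR
  have hcofin : CofinalIn κ (hereditary (succ lam)) {N | N ∈ smallSubsets κ (hereditary (succ lam)) ∧
      IsClosedUnder G N ∧ IsOrdinalDirected χ lam.ord N} := by
    refine ⟨fun _ h => h.1, fun M hM => ?_⟩
    obtain ⟨N, hN, hMN, h⟩ := exists_closed_directed hχ hχκ hκlam hκ hcof hG hM
    exact ⟨N, ⟨hN, h⟩, hMN⟩
  obtain ⟨M, ⟨hM, ⟨-, hMcof⟩, -, hguess⟩, -, hMG⟩ :=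
    (hAGP _ hcofin lam.ord.toZFSet (mem_hereditary_of_subset_toZFSet fun _ h => h)).2 _
      (isStrongClub_isClosedUnder hκ hunc hG)
  have hMrich := hrich M hMG
  have hδ := supBelow_lt hcof hM.2
  obtain ⟨i, hi, hunb⟩ := hMrich.exists_unbounded_index hlim hR hδ hMcof
  obtain ⟨N, ⟨-, hNG, hdir⟩, -, hNM, hg⟩ := hguess _ (relationCode_subset (R := R) i _)
    (hMrich.isApproximated hχ hχlam hR hδ hi hunb)
  exact (hrich N hNG).not_isGuessed hχ hχlam hR hdir hi hδ
    (fun α hα hαN => hMrich.lt_supBelow hlim hα (hNM hαN)) hg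

end Guessing

theorem WAGP.mono {Y Y' : Set ZFSet.{u}} {μ κ θ : Cardinal.{u}} (hY : Y ⊆ Y')
    (h : WAGP Y μ κ θ) : WAGP Y' μ κ θ := fun S hS x hx =>
  ⟨fun _ hM => hM.1, fun C hC =>
    ((h S hS x hx).2 C hC).mono fun _ hM => ⟨⟨hM.1.1, hY hM.1.2.1, hM.1.2.2⟩, hM.2⟩⟩

theorem isUnboundedSubadditive_of_isStronglyUnbounded {χ lam : Cardinal.{u}}
    {c : OrdPairs lam.ord → Iio χ.ord} (hsub : IsSubadditive c) (hunb : IsStronglyUnbounded c) :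
    IsUnboundedSubadditive (fun i α β => ∃ (hα : α < lam.ord) (hβ : β < lam.ord) (h : α < β),
      (c ⟨(⟨α, hα⟩, ⟨β, hβ⟩), h⟩ : Ordinal.{u}) ≤ i) χ.ord lam.ord := by
  refine ⟨?_, ?_, ?_, ?_, ?_⟩
  · rintro i j α β hij ⟨hα, hβ, h, hc⟩
    exact ⟨hα, hβ, h, hc.trans hij⟩
  · intro α β h hβ
    exact ⟨_, (c ⟨(⟨α, h.trans hβ⟩, ⟨β, hβ⟩), h⟩).2, h.trans hβ, hβ, h, le_rfl⟩
  · rintro i α β γ hαβ hβγ hγ ⟨hα, hβ, _, h1⟩ ⟨_, _, _, h2⟩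
    refine ⟨hα, hγ, hαβ.trans hβγ, ?_⟩
    rcases le_max_iff.1 (hsub ⟨α, hα⟩ ⟨β, hβ⟩ ⟨γ, hγ⟩ hαβ hβγ).1 with h | h
    · exact le_trans h h1
    · exact le_trans h h2
  · rintro i α β γ hαβ hβγ hγ ⟨hα, _, _, h1⟩ ⟨hβ, _, _, h2⟩
    refine ⟨hα, hβ, hαβ, ?_⟩
    rcases le_max_iff.1 (hsub ⟨α, hα⟩ ⟨β, hβ⟩ ⟨γ, hγ⟩ hαβ hβγ).2 with h | h
    · exact le_trans h h1
    · exact le_trans h h2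
  · intro A hA i hi
    by_contra! hcon
    refine hunb (Subtype.val ⁻¹' A) ?_ ⟨⟨i, hi⟩, ?_⟩
    · rintro ⟨⟨b, hb⟩, hbA⟩
      obtain ⟨δ, hδ, hlt⟩ := hA.2 b hb
      exact hlt.not_ge (hbA (show (⟨δ, hA.1 hδ⟩ : Iio lam.ord) ∈ Subtype.val ⁻¹' A from hδ))
    · rintro _ ⟨⟨⟨α, β⟩, hαβ⟩, ⟨hα, hβ⟩, rfl⟩
      obtain ⟨_, _, _, h⟩ := hcon α hα β hβ hαβ
      exact h

theorem mainTheorem3 (χ κ lam : Cardinal.{u}) (hχ : ℵ₀ ≤ χ) (hχκ : succ χ < κ) (hκlam : κ ≤ lam)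
    (hκ : κ.IsRegular) (hcof : κ ≤ lam.ord.cof)
    (hAGP : WAGP (largeCofinality χ κ lam) κ κ (succ lam)) :
    (¬ ∃ c : OrdPairs lam.ord → Iio χ.ord, IsSubadditive c ∧ IsStronglyUnbounded c) ∧
      (lam.IsRegular → ¬ SquarePrinciple lam) := by
  have hunc : ℵ₀ < lam := (hχ.trans_lt ((lt_succ χ).trans hχκ)).trans_le hκlam
  refine ⟨fun ⟨c, hsub, hunb⟩ => ?_, fun hreg hsq => ?_⟩
  · exact not_isUnboundedSubadditive_of_WAGP hχ hχκ hκlam hκ hcof hAGP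
      (isUnboundedSubadditive_of_isStronglyUnbounded hsub hunb)
  -- The walk function has countable range, so the first part is applied with ℵ₀ for χ; cofinality
  -- above χ implies cofinality above ℵ₀.
  · obtain ⟨R, hR⟩ := exists_isUnboundedSubadditive_of_squarePrinciple hreg hunc hsq
    exact not_isUnboundedSubadditive_of_WAGP le_rfl ((succ_le_succ hχ).trans_lt hχκ) hκlam hκ hcof
      (hAGP.mono fun _ hM => ⟨hM.1, hχ.trans_lt hM.2⟩) hR
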